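/- **Setting.** An interval is a nonempty closed interval $I=[\mathrm{left}(I),\mathrm{right}(I)]$ of the real line, of arbitrary length. A finite set of intervals is *independent* if its elements are pairwise disjoint. A sliding-window algorithm with window length $L\ge 1$ reads an infinite stream of intervals one by one; at every moment, let $W$ be the set of the $L$ most recent intervals (all of them, if fewer than $L$ have arrived) and let $OPT$ be a maximum-cardinality independent subset of $W$. The algorithm is a *$c$-approximation* for Interval Selection if on every stream and at every moment it outputs an independent subset $S\subseteq W$ with $|OPT|\le c\,|S|$. Space is counted in memory words; an interval, a region boundary and a counter bounded by $L$ take one word each. **Algorithm $\mathcal{CP}$ (Cabello–Pérez-Lantero).** A run keeps a partition of $\mathbb R$ into consecutive regions, initially the single region $\mathbb R$, and for each region $R$ two intervals of the stream that lie within $R$: $\mathrm{leftmost}(R)$, with smallest right endpoint, and $\mathrm{rightmost}(R)$, with largest left endpoint (ties go to the shorter interval). The first interval $I$ of the run becomes the leftmost and the rightmost interval of $\mathbb R$. An arriving interval $I$ that lies within no region is ignored. Suppose that $I$ lies within the region $R$, with leftmost interval $l$ and rightmost interval $r$. If $I\cap l\cap r\ne\emptyset$, then $I$ only updates $l$ and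 $r$. Otherwise, if $\mathrm{right}(I)\le\mathrm{left}(r)$, $R$ is split just before the point $\mathrm{left}(r)$; the left part stores $I$ as leftmost and rightmost interval, the right part stores $r$ as both. In the remaining case $R$ is split just after the point $\mathrm{right}(l)$; the left part stores $l$ as both, the right part stores $I$ as both. The solution of the run consists of the leftmost intervals of all regions; $|\mathcal{CP}_i|$ denotes the number of intervals in the solution of a run $\mathcal{CP}_i$. **Algorithm $\mathcal A_{\beta,L}$ (parameter $\beta>0$, window length $L$).** It maintains runs $\mathcal{CP}_1,\mathcal{CP}_2,\dots$ of $\mathcal{CP}$, ordered from the oldest to the youngest starting time. When an interval arrives, it creates a new run, feeds the interval into all runs, and removes the oldest run if that run started before the current window. Then, for $i=1,2,\dots$ as long as $\mathcal{CP}_i$ exists, it finds the largest $j>i$ with $|\mathcal{CP}_i|\le(1+\beta)|\mathcal{CP}_j|$; if such a $j$ exists, it deletes all runs strictly between $\mathcal{CP}_i$ and $\mathcal{CP}_j$ and renumbers. Whenever two runs $\mathcal{CP}_i,\mathcal{CP}_{i+1}$ become adjacent (by such a deletion or because $\mathcal{CP}_{i+1}$ was just created), let $R_1,\dots,R_\ell$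 be the current regions of $\mathcal{CP}_i$ from left to right. The algorithm records the current solution of $\mathcal{CP}_{i+1}$ and starts, for every $R_k$ and for every merged pair $R_kR_{k+1}$, a new run of $\mathcal{CP}$ that considers only the subsequent intervals lying within $R_k$, respectively $R_kR_{k+1}$. The recorded solution and these runs are associated with $\mathcal{CP}_{i+1}$: they replace those associated with it before, and they are deleted when $\mathcal{CP}_{i+1}$ is deleted. The output is a maximum independent set among all intervals stored by the oldest run together with the recorded solution and the runs associated with it. **Theorem.** Let $\delta>0$ be a constant and $\beta=\delta/4$. For every $L\ge1$, the deterministic algorithm $\mathcal A_{\beta,L}$ is a $\left(\tfrac{11}{3}+\delta\right)$-approximation sliding-window algorithm for Interval Selection on arbitrary-length intervals. It uses $\tilde O(|OPT|)$ space: there are $C>0$ and $k\in\mathbb N$, depending only on $\delta$, such that for every $L\ge1$, on every stream and at every moment, it uses at most $C\cdot|OPT|\cdot(1+\log L)^k$ words, where $OPT$ is an optimal solution in the current window. -/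

import Mathlib

open scoped Classical

noncomputable section

namespace IntervalSelection

/-! ### Intervals, independent sets, sliding windows

An interval is a nonempty closed interval `[I.fst, I.snd]` of the real line, of any length, that
is, an element of `NonemptyInterval ℝ`; its coercion to a set is `Set.Icc I.fst I.snd`. -/

abbrev Interval : Type := NonemptyInterval ℝ

/-- Pairwise non-overlapping. -/
def Independent (S : Finset Interval) : Prop :=
  (S : Set Interval).Pairwise fun I J => Disjoint (I : Set ℝ) (J : Set ℝ)

theorem independent_empty : Independent ∅ := by
  simp [Independent]

theorem exists_max_independent (S : Finset Interval) :
    ∃ T : Finset Interval, (T ⊆ S ∧ Independent T) ∧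
      ∀ T' : Finset Interval, T' ⊆ S → Independent T' → T'.card ≤ T.card := by
  obtain ⟨T, hT, hmax⟩ := Finset.exists_max_image
    (S.powerset.filter fun T => Independent T) Finset.card
    ⟨∅, by simp [independent_empty]⟩
  refine ⟨T, by simpa using hT, fun T' h h' => hmax T' ?_⟩
  simp [h, h']

/-- `OPT(S)`: an independent subset of `S` of maximum cardinality. -/
def opt (S : Finset Interval) : Finset Interval := (exists_max_independent S).choose

theorem opt_spec (S : Finset Interval) :
    (opt S ⊆ S ∧ Independent (opt S)) ∧
      ∀ T : Finset Interval, T ⊆ S → Independent T → T.card ≤ (opt S).card :=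
  (exists_max_independent S).choose_spec

/-- The sliding window of length `L` after the first `t` items `σ 0, …, σ (t - 1)` of the stream:
the `L` most recent ones, or all of them while `t < L`. -/
def window (σ : ℕ → Interval) (L t : ℕ) : Finset Interval :=
  (Finset.Ico (t - L) t).image σ

/-- A deterministic algorithm on a stream of intervals. `space` is the number of memory words that
a memory state occupies, where an interval takes one word. -/
structure StreamAlgorithm where
  State : Type
  init : State
  step : State → Interval → State
  output : State → Finset Interval
  space : State → ℕ

/-- The memory state after the first `t` items of the stream. -/
def StreamAlgorithm.stateAt (A : StreamAlgorithm) (σ : ℕ → Interval) : ℕ → A.State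
  | 0 => A.init
  | t + 1 => A.step (A.stateAt σ t) (σ t)

/-- On every stream and at every moment, the output is an independent set of intervals of the
current window, and it is at most a factor `c` smaller than an optimal one. -/
def StreamAlgorithm.IsSlidingWindowApprox (A : StreamAlgorithm) (L : ℕ) (c : ℝ) : Prop :=
  ∀ (σ : ℕ → Interval) (t : ℕ),
    A.output (A.stateAt σ t) ⊆ window σ L t ∧
    Independent (A.output (A.stateAt σ t)) ∧
    ((opt (window σ L t)).card : ℝ) ≤ c * ((A.output (A.stateAt σ t)).card : ℝ)

/-- The family `A L` (one algorithm for each window length `L ≥ 1`) uses space `Õ(|OPT|)` at every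
moment, where `OPT` is an optimal solution in the current window: space `O(|OPT|)` up to a factor
polylogarithmic in `L`, uniformly over all window lengths, streams and moments. -/
def UsesSoftOSpaceOpt (A : ℕ → StreamAlgorithm) : Prop :=
  ∃ (C : ℝ) (k : ℕ), ∀ L : ℕ, 1 ≤ L → ∀ (σ : ℕ → Interval) (t : ℕ),
    ((A L).space ((A L).stateAt σ t) : ℝ) ≤
      C * ((opt (window σ L t)).card : ℝ) * (1 + Real.log L) ^ k

/-! ### Regions -/

/-- A boundary between two regions: a cut of the real line just before or just after a point, or
one of the two ends of the line. -/
inductive Cut where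
  | negInf : Cut
  | before (x : ℝ) : Cut
  | after (x : ℝ) : Cut
  | posInf : Cut

/-- The points to the left of a cut. -/
def Cut.leftPart : Cut → Set ℝ
  | .negInf => ∅
  | .before x => Set.Iio x
  | .after x => Set.Iic x
  | .posInf => Set.univ

/-- A region: the points between the cuts `lo` and `hi`. -/
structure Region where
  lo : Cut
  hi : Cut

def Region.toSet (R : Region) : Set ℝ := R.hi.leftPart \ R.lo.leftPart

def Region.line : Region := ⟨.negInf, .posInf⟩

/-- The interval `I` lies within the region `R`. -/
def Region.Contains (R : Region) (I : Interval) : Prop := (I : Set ℝ) ⊆ R.toSet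

/-! ### The Cabello–Pérez-Lantero algorithm -/

/-- A region of the current partition with its leftmost interval (smallest right endpoint) and its
rightmost interval (largest left endpoint). `none` is the initial situation, in which no interval
has been seen in the region. -/
structure Cell where
  region : Region
  stored : Option (Interval × Interval)

/-- The new leftmost interval, when `I` arrives and `l` was leftmost; among intervals with the same
right endpoint the shortest is preferred. -/
def newLeftmost (l I : Interval) : Interval :=
  if I.snd < l.snd ∨ (I.snd = l.snd ∧ l.fst ≤ I.fst) then I else l

/-- The new rightmost interval, when `I` arrives and `r` was rightmost; among intervals with the
same left endpoint the shortest is preferred. -/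
def newRightmost (r I : Interval) : Interval :=
  if r.fst < I.fst ∨ (I.fst = r.fst ∧ I.snd ≤ r.snd) then I else r

/-- What becomes of a region when the interval `I` arrives. An interval that does not lie within
the region is ignored. An interval that meets both the leftmost and the rightmost interval only
updates these. An interval that is disjoint from one of them splits the region in two: just before
the left endpoint of the rightmost interval, or just after the right endpoint of the leftmost
interval. -/
def Cell.step (I : Interval) (c : Cell) : List Cell :=
  if c.region.Contains I then
    match c.stored with
    | none => [⟨c.region, some (I, I)⟩]
    | some (l, r) =>
      if ((I : Set ℝ) ∩ (l : Set ℝ) ∩ (r : Set ℝ)).Nonempty then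
        [⟨c.region, some (newLeftmost l I, newRightmost r I)⟩]
      else if I.snd ≤ r.fst then
        [⟨⟨c.region.lo, .before r.fst⟩, some (I, I)⟩,
          ⟨⟨.before r.fst, c.region.hi⟩, some (r, r)⟩]
      else
        [⟨⟨c.region.lo, .after l.snd⟩, some (l, l)⟩,
          ⟨⟨.after l.snd, c.region.hi⟩, some (I, I)⟩]
  else [c]

/-- The memory of a run of the algorithm: the regions, from left to right. -/
abbrev CP : Type := List Cell

def CP.init : CP := [⟨Region.line, none⟩]

/-- The regions are disjoint, so at most one of them is affected. -/
def CP.step (P : CP) (I : Interval) : CP := List.flatMap (Cell.step I) P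

/-- The solution: the leftmost interval of each region. -/
def CP.solution (P : CP) : List Interval :=
  List.filterMap (fun c : Cell => c.stored.map Prod.fst) P

def CP.size (P : CP) : ℕ := P.solution.length

def CP.regions (P : CP) : List Region := List.map Cell.region P

/-- All intervals in memory, leftmost and rightmost ones. -/
def CP.intervals (P : CP) : List Interval :=
  List.flatMap (fun c : Cell => c.stored.toList.flatMap fun p => [p.1, p.2]) P

/-- Two boundaries and two intervals for each region. -/
def CP.words (P : CP) : ℕ := 4 * List.length P

/-- A run that only considers the intervals that lie within `domain`. -/
structure RestrictedRun where
  domain : Region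
  cp : CP

def RestrictedRun.start (R : Region) : RestrictedRun := ⟨R, CP.init⟩

def RestrictedRun.step (I : Interval) (Q : RestrictedRun) : RestrictedRun :=
  if Q.domain.Contains I then ⟨Q.domain, Q.cp.step I⟩ else Q

def RestrictedRun.words (Q : RestrictedRun) : ℕ := 2 + Q.cp.words

/-! ### The sliding window algorithm -/

/-- The regions obtained by merging two consecutive regions. -/
def mergedPairs : List Region → List Region
  | R :: R' :: Rs => ⟨R.lo, R'.hi⟩ :: mergedPairs (R' :: Rs)
  | _ => []

/-- A run of the smooth histogram. `age` is the number of intervals that it has been fed, so that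
it started with the `age`-th most recent interval of the stream. The other fields belong to the
moment at which the run became adjacent to its predecessor (the next older run): `snapshot` is the
solution of the run at that moment, and `singles` and `pairs` are its associated runs, one for each
region and one for each pair of consecutive regions that the predecessor had at that moment. -/
structure Run where
  age : ℕ
  cp : CP
  snapshot : List Interval
  singles : List RestrictedRun
  pairs : List RestrictedRun

def Run.start : Run := ⟨0, CP.init, [], [], []⟩

def Run.size (r : Run) : ℕ := r.cp.size

def Run.feed (I : Interval) (r : Run) : Run :=
  ⟨r.age + 1, r.cp.step I, r.snapshot, r.singles.map (RestrictedRun.step I),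
    r.pairs.map (RestrictedRun.step I)⟩

/-- What is done when `r` becomes adjacent to the older run `p`. -/
def Run.becomeAdjacent (p r : Run) : Run :=
  ⟨r.age, r.cp, r.cp.solution, p.cp.regions.map RestrictedRun.start,
    (mergedPairs p.cp.regions).map RestrictedRun.start⟩

/-- All intervals in the memory of a run and of its associated runs. -/
def Run.intervals (r : Run) : List Interval :=
  r.cp.intervals ++ r.snapshot ++ r.singles.flatMap (fun Q => Q.cp.intervals) ++
    r.pairs.flatMap (fun Q => Q.cp.intervals)

def Run.words (r : Run) : ℕ :=
  1 + r.cp.words + r.snapshot.length + (r.singles.map RestrictedRun.words).sum +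
    (r.pairs.map RestrictedRun.words).sum

/-- Discards everything before the last element that satisfies `p`; if there is none, discards
nothing. -/
def dropBeforeLast {α : Type} (p : α → Prop) : List α → List α
  | [] => []
  | a :: as => if ∃ b ∈ as, p b then dropBeforeLast p as else a :: as

theorem length_dropBeforeLast_le {α : Type} (p : α → Prop) (as : List α) :
    (dropBeforeLast p as).length ≤ as.length := by
  induction as with
  | nil => simp [dropBeforeLast]
  | cons a as ih =>
    unfold dropBeforeLast
    split_ifs
    · exact ih.trans (by simp)
    · exact le_rfl

/-- Deletes the runs strictly between `r` and the last of the younger runs `rs` whose size is at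
least that of `r` up to the factor `1 + β`. If this deletes a run, then `r` gets a new neighbour. -/
def prune (β : ℝ) (r : Run) (rs : List Run) : List Run :=
  match dropBeforeLast (fun q : Run => (r.size : ℝ) ≤ (1 + β) * (q.size : ℝ)) rs with
  | [] => []
  | q :: qs => if qs.length + 1 < rs.length then r.becomeAdjacent q :: qs else q :: qs

theorem length_prune_le (β : ℝ) (r : Run) (rs : List Run) :
    (prune β r rs).length ≤ rs.length := by
  have h := length_dropBeforeLast_le (fun q : Run => (r.size : ℝ) ≤ (1 + β) * (q.size : ℝ)) rs
  unfold prune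
  split
  · simp
  · rename_i q qs heq
    rw [heq] at h
    split_ifs <;> simpa using h

/-- The clean-up of the smooth histogram, from the oldest run to the youngest. -/
def cleanUp (β : ℝ) : List Run → List Run
  | [] => []
  | r :: rs => r :: cleanUp β (prune β r rs)
  termination_by rs => rs.length
  decreasing_by
    simpa using Nat.lt_succ_of_le (length_prune_le β r rs)

/-- Appends the newly created run, which becomes adjacent to the youngest of the other runs. -/
def insertNew (rs : List Run) (new : Run) : List Run :=
  match rs.getLast? with
  | none => [new]
  | some p => rs ++ [p.becomeAdjacent new]

/-- Removes the oldest run if it started before the current window of length `L`. -/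
def removeExpired (L : ℕ) : List Run → List Run
  | [] => []
  | r :: rs => if L < r.age then rs else r :: rs

/-- The sliding window algorithm for window length `L`, with smooth histogram parameter `β`. The
memory state is the list of the runs, from the oldest to the youngest. The output is a largest
independent set among the intervals in the memory of the oldest run and its associated runs. -/
def slidingWindowAlgorithm (β : ℝ) (L : ℕ) : StreamAlgorithm where
  State := List Run
  init := []
  step := fun rs I =>
    cleanUp β (removeExpired L (insertNew (rs.map (Run.feed I)) (Run.start.feed I)))
  output := fun rs =>
    match rs with
    | [] => ∅
    | r :: _ => opt r.intervals.toFinset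
  space := fun rs => (rs.map Run.words).sum

end IntervalSelection

end

namespace IntervalSelection

/-! ### Cuts, regions and intervals -/

/-! A run with m regions determines the optimum of what it has read up to a factor 2. In each region
the leftmost and rightmost interval meet and are extremal, so any two intervals read within that
region meet. An independent set thus has at most one element in each region and one across each of
the m - 1 inner boundaries: |OPT| ≤ 2m - 1 (`CP.Invariant.opt_add_one_le`). The m leftmost intervals
are independent, so also m ≤ |OPT| (`CP.Invariant.size_le_opt`).

Approximation (`CP.Invariant.exists_combination`, `Run.Linked.opt_items_le`). Suppose that the
oldest run had a predecessor, now expired, which therefore saw the whole window. When the two became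
adjacent, after u items, they were in states P and Q. If their starting times are consecutive, the
oldest run covers the whole window and the factor 2 suffices. Otherwise |P| ≤ (1 + β)|Q|. Let n_R be
the optimum within a region R of P among the intervals stored by the associated restricted runs, n
the sum of the n_R, and k the number of regions with n_R > 0. An optimal O has in R at most one
interval from before u, and at most 2 n_R - 1 later ones (none if n_R = 0). With the crossing
intervals, |O| + k ≤ 2n + 2|P|. The output size d satisfies d ≥ n and d ≥ s ≥ |Q|, where s is the
optimum of the snapshot. Also d ≥ s + n - 3k, since what was found inside one region meets at most
three independent intervals of the snapshot (`Independent.card_meeting_le_three`). Distinguishing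
|P| ≤ 3k from |P| > 3k yields |O| ≤ (11/3 + 4β) d. The runs on merged pairs are not needed for this
bound; they only have to fit into the space and to store window intervals.

Space. The clean-up makes sizes drop by a factor above 1 + β every two runs (`Sparse.pow_le_size`),
and sizes are at most L, so there are O(log L) runs. Each takes O(|OPT|) words
(`Run.Linked.words_le`), because optima within disjoint regions add up to at most |OPT| and merged
pairs cover the line at most twice. -/

theorem mem_interval {I : Interval} {x : ℝ} : x ∈ (I : Set ℝ) ↔ I.fst ≤ x ∧ x ≤ I.snd := Iff.rfl

theorem disjoint_interval_iff {I J : Interval} :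
    Disjoint (I : Set ℝ) (J : Set ℝ) ↔ I.snd < J.fst ∨ J.snd < I.fst := by
  have hI := I.fst_le_snd
  have hJ := J.fst_le_snd
  rw [Set.disjoint_left]
  constructor
  · intro h
    by_contra! hc
    refine h (a := max I.fst J.fst) ?_ ?_
    · exact mem_interval.2 ⟨le_max_left _ _, max_le hI hc.1⟩
    · exact mem_interval.2 ⟨le_max_right _ _, max_le hc.2 hJ⟩
  · rintro h x hx hy
    rw [mem_interval] at hx hy
    rcases h with h | h <;> linarith [hx.1, hx.2, hy.1, hy.2]

@[simp] theorem Cut.mem_leftPart_before {x y : ℝ} : y ∈ (Cut.before x).leftPart ↔ y < x := Iff.rfl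

@[simp] theorem Cut.mem_leftPart_after {x y : ℝ} : y ∈ (Cut.after x).leftPart ↔ y ≤ x := Iff.rfl

theorem Cut.leftPart_lower (c : Cut) {x y : ℝ} (h : y ≤ x) (hx : x ∈ c.leftPart) :
    y ∈ c.leftPart := by
  cases c <;> simp only [Cut.leftPart, Set.mem_empty_iff_false, Set.mem_Iio, Set.mem_Iic,
    Set.mem_univ] at hx ⊢ <;> linarith

theorem Cut.lt_of_mem_of_notMem {c : Cut} {x y : ℝ} (hx : x ∈ c.leftPart)
    (hy : y ∉ c.leftPart) : x < y := by
  by_contra! h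
  exact hy (c.leftPart_lower h hx)

theorem Cut.leftPart_subset_of_mem {c d : Cut} {x : ℝ} (hc : x ∉ c.leftPart)
    (hd : x ∈ d.leftPart) : c.leftPart ⊆ d.leftPart :=
  fun _ hy => d.leftPart_lower (Cut.lt_of_mem_of_notMem hy hc).le hd

theorem Region.contains_iff {R : Region} {I : Interval} :
    R.Contains I ↔ I.fst ∉ R.lo.leftPart ∧ I.snd ∈ R.hi.leftPart := by
  have hI := I.fst_le_snd
  constructor
  · intro h
    exact ⟨(h (mem_interval.2 ⟨le_rfl, hI⟩)).2, (h (mem_interval.2 ⟨hI, le_rfl⟩)).1⟩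
  · rintro ⟨h1, h2⟩ x hx
    rw [mem_interval] at hx
    exact ⟨R.hi.leftPart_lower hx.2 h2, fun h => h1 (R.lo.leftPart_lower hx.1 h)⟩

theorem Region.Contains.leftPart_subset {R : Region} {I : Interval} (h : R.Contains I) :
    R.lo.leftPart ⊆ R.hi.leftPart := by
  rw [Region.contains_iff] at h
  exact Cut.leftPart_subset_of_mem h.1 (R.hi.leftPart_lower I.fst_le_snd h.2)

theorem Region.line_contains (I : Interval) : Region.line.Contains I := by
  simp [Region.contains_iff, Region.line, Cut.leftPart]

theorem Region.Contains.mono {a b a' b' : Cut} {I : Interval} (h : Region.Contains ⟨a, b⟩ I)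
    (ha : a'.leftPart ⊆ a.leftPart) (hb : b.leftPart ⊆ b'.leftPart) :
    Region.Contains ⟨a', b'⟩ I := by
  rw [Region.contains_iff] at h ⊢
  exact ⟨fun h' => h.1 (ha h'), hb h.2⟩

/-- The interval has points on both sides of the cut. -/
def Cut.Crosses (c : Cut) (I : Interval) : Prop := I.fst ∈ c.leftPart ∧ I.snd ∉ c.leftPart

/-! ### Independent sets -/

theorem Independent.mono {S T : Finset Interval} (hT : Independent T) (h : S ⊆ T) :
    Independent S :=
  Set.Pairwise.mono (by exact_mod_cast h) hT

theorem independent_singleton (I : Interval) : Independent {I} := by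
  simp [Independent]

theorem Independent.eq_of_meet {T : Finset Interval} (hT : Independent T) {I J : Interval}
    (hI : I ∈ T) (hJ : J ∈ T) (h1 : I.fst ≤ J.snd) (h2 : J.fst ≤ I.snd) : I = J := by
  by_contra hne
  have := disjoint_interval_iff.1 (hT (by exact_mod_cast hI) (by exact_mod_cast hJ) hne)
  rcases this with h | h <;> linarith

theorem Independent.union {S T : Finset Interval} (hS : Independent S) (hT : Independent T)
    (h : ∀ I ∈ S, ∀ J ∈ T, Disjoint (I : Set ℝ) (J : Set ℝ)) :
    Independent (S ∪ T) ∧ (S ∪ T).card = S.card + T.card := by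
  constructor
  · intro I hI J hJ hne
    simp only [Finset.coe_union, Set.mem_union, Finset.mem_coe] at hI hJ
    rcases hI with hI | hI <;> rcases hJ with hJ | hJ
    · exact hS hI hJ hne
    · exact h I hI J hJ
    · exact (h J hJ I hI).symm
    · exact hT hI hJ hne
  · refine Finset.card_union_of_disjoint (Finset.disjoint_left.2 fun I hI hI' => ?_)
    have := I.fst_le_snd
    rcases disjoint_interval_iff.1 (h I hI I hI') with h | h <;> linarith

/-- If two intervals cross the same cut, each begins before the other ends, so they meet. -/
theorem Independent.card_crosses_le_one {T : Finset Interval} (hT : Independent T) (c : Cut) :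
    (T.filter c.Crosses).card ≤ 1 := by
  rw [Finset.card_le_one]
  intro I hI J hJ
  rw [Finset.mem_filter] at hI hJ
  exact hT.eq_of_meet hI.1 hJ.1 (Cut.lt_of_mem_of_notMem hI.2.1 hJ.2.2).le
    (Cut.lt_of_mem_of_notMem hJ.2.1 hI.2.2).le

/-- An interval that meets something inside `R` lies within `R` or crosses one of its two
boundaries, whence 1 + 1 + 1. -/
theorem Independent.card_meeting_le_three {T : Finset Interval} (hT : Independent T) (R : Region)
    (hR : (T.filter R.Contains).card ≤ 1) :
    (T.filter fun J : Interval => ∃ I : Interval, R.Contains I ∧ ¬ Disjoint (J : Set ℝ) (I : Set ℝ)).card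
      ≤ 3 := by
  have hsub : (T.filter fun J : Interval => ∃ I : Interval, R.Contains I ∧
      ¬ Disjoint (J : Set ℝ) (I : Set ℝ)) ⊆
      T.filter R.Contains ∪ (T.filter R.lo.Crosses ∪ T.filter R.hi.Crosses) := by
    intro J hJ
    simp only [Finset.mem_filter, Finset.mem_union] at hJ ⊢
    obtain ⟨hJT, I, hI, hd⟩ := hJ
    rw [disjoint_interval_iff] at hd
    push Not at hd
    rw [Region.contains_iff] at hI
    by_cases h1 : J.fst ∈ R.lo.leftPart
    · exact Or.inr (Or.inl ⟨hJT, h1, fun h => hI.1 (R.lo.leftPart_lower hd.1 h)⟩)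
    · by_cases h2 : J.snd ∈ R.hi.leftPart
      · exact Or.inl ⟨hJT, Region.contains_iff.2 ⟨h1, h2⟩⟩
      · exact Or.inr (Or.inr ⟨hJT, R.hi.leftPart_lower hd.2 hI.2, h2⟩)
  have h1 := Finset.card_le_card hsub
  have h2 := Finset.card_union_le (T.filter R.Contains)
    (T.filter R.lo.Crosses ∪ T.filter R.hi.Crosses)
  have h3 := Finset.card_union_le (T.filter R.lo.Crosses) (T.filter R.hi.Crosses)
  have h4 := hT.card_crosses_le_one R.lo
  have h5 := hT.card_crosses_le_one R.hi
  omega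

theorem opt_subset (S : Finset Interval) : opt S ⊆ S := (opt_spec S).1.1

theorem opt_independent (S : Finset Interval) : Independent (opt S) := (opt_spec S).1.2

theorem Independent.card_le_opt {S T : Finset Interval} (hT : Independent T) (h : T ⊆ S) :
    T.card ≤ (opt S).card :=
  (opt_spec S).2 T h hT

theorem card_opt_mono {S T : Finset Interval} (h : S ⊆ T) : (opt S).card ≤ (opt T).card :=
  (opt_independent S).card_le_opt ((opt_subset S).trans h)

theorem one_le_card_opt {S : Finset Interval} (h : S.Nonempty) : 1 ≤ (opt S).card := by
  obtain ⟨I, hI⟩ := h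
  simpa using (independent_singleton I).card_le_opt (S := S) (by simpa using hI)

/-- The size of an optimal solution among the intervals that lie within a region. -/
noncomputable def optIn (S : Finset Interval) (R : Region) : ℕ :=
  (opt (S.filter R.Contains)).card

theorem optIn_mono {S T : Finset Interval} (h : S ⊆ T) (R : Region) : optIn S R ≤ optIn T R :=
  card_opt_mono (Finset.filter_subset_filter _ h)

theorem optIn_le (S : Finset Interval) (R : Region) : optIn S R ≤ (opt S).card :=
  card_opt_mono (Finset.filter_subset _ _)

theorem one_le_optIn {S : Finset Interval} {R : Region} {I : Interval} (hI : I ∈ S)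
    (hR : R.Contains I) : 1 ≤ optIn S R :=
  one_le_card_opt ⟨I, by simp [hI, hR]⟩

/-! ### Tilings -/

/-- The regions are consecutive, from the cut `a` to the cut `b`. -/
def IsTiling : Cut → List Region → Cut → Prop
  | a, [], b => a = b
  | a, R :: Rs, b => R.lo = a ∧ a.leftPart ⊆ R.hi.leftPart ∧ IsTiling R.hi Rs b

theorem IsTiling.leftPart_subset {Rs : List Region} {a b : Cut} (h : IsTiling a Rs b) :
    a.leftPart ⊆ b.leftPart := by
  induction Rs generalizing a with
  | nil => rw [show a = b from h]
  | cons R Rs ih => exact h.2.1.trans (ih h.2.2)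

theorem IsTiling.append {Rs Ss : List Region} {a b c : Cut} (h : IsTiling a Rs b)
    (h' : IsTiling b Ss c) : IsTiling a (Rs ++ Ss) c := by
  induction Rs generalizing a with
  | nil => rw [show a = b from h]; exact h'
  | cons R Rs ih => exact ⟨h.1, h.2.1, ih h.2.2⟩

/-- Optimal sets of different regions are separated by cuts, so their union is independent. The set
itself is kept, with the region of each element, because the combination argument asks which
snapshot intervals it meets. -/
theorem IsTiling.exists_independent {Rs : List Region} {a b : Cut} (h : IsTiling a Rs b)
    (S : Finset Interval) :
    ∃ U ⊆ S.filter (Region.Contains ⟨a, b⟩), Independent U ∧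
      (∀ I ∈ U, ∃ R ∈ Rs, R.Contains I) ∧ (Rs.map (optIn S)).sum ≤ U.card := by
  induction Rs generalizing a with
  | nil => exact ⟨∅, by simp, independent_empty, by simp, by simp⟩
  | cons R Rs ih =>
    obtain ⟨hlo, hle, hRs⟩ := h
    obtain ⟨U, hU, hind, hin, hcard⟩ := ih hRs
    have hopt : ∀ I ∈ opt (S.filter R.Contains), I ∈ S ∧ R.Contains I := fun I hI => by
      simpa using opt_subset _ hI
    have hU' : ∀ I ∈ U, I ∈ S ∧ Region.Contains ⟨R.hi, b⟩ I := fun I hI => by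
      simpa using hU hI
    obtain ⟨h1, h2⟩ := (opt_independent (S.filter R.Contains)).union hind fun I hI J hJ =>
      disjoint_interval_iff.2 (Or.inl (Cut.lt_of_mem_of_notMem
        (Region.contains_iff.1 (hopt I hI).2).2 (Region.contains_iff.1 (hU' J hJ).2).1))
    refine ⟨_, ?_, h1, ?_, ?_⟩
    · intro I hI
      rw [Finset.mem_filter]
      rcases Finset.mem_union.1 hI with hI | hI
      · refine ⟨(hopt I hI).1, ?_⟩
        have := (hopt I hI).2
        rw [← hlo]
        exact Region.Contains.mono this subset_rfl hRs.leftPart_subset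
      · exact ⟨(hU' I hI).1, (hU' I hI).2.mono hle subset_rfl⟩
    · intro I hI
      rcases Finset.mem_union.1 hI with hI | hI
      · exact ⟨R, by simp, (hopt I hI).2⟩
      · obtain ⟨R', hR', h'⟩ := hin I hI
        exact ⟨R', by simp [hR'], h'⟩
    · rw [h2, List.map_cons, List.sum_cons]
      exact Nat.add_le_add le_rfl hcard

theorem IsTiling.sum_optIn_le {Rs : List Region} {a b : Cut} (h : IsTiling a Rs b)
    (S : Finset Interval) : (Rs.map (optIn S)).sum ≤ optIn S ⟨a, b⟩ := by
  obtain ⟨U, hU, hind, -, hcard⟩ := h.exists_independent S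
  exact hcard.trans (hind.card_le_opt hU)

theorem optIn_add_le (S : Finset Interval) {a b c : Cut} (hab : a.leftPart ⊆ b.leftPart)
    (hbc : b.leftPart ⊆ c.leftPart) : optIn S ⟨a, b⟩ + optIn S ⟨b, c⟩ ≤ optIn S ⟨a, c⟩ := by
  have h : IsTiling a [⟨a, b⟩, ⟨b, c⟩] c := ⟨rfl, hab, rfl, hbc, rfl⟩
  simpa using h.sum_optIn_le S

/-- The pairs at odd positions are mutually disjoint, and so are those at even positions, which
start only at `R.hi`. The two families exchange roles in the induction. -/
theorem IsTiling.sum_optIn_mergedPairs_le {R : Region} {Rs : List Region} {a b : Cut}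
    (h : IsTiling a (R :: Rs) b) (S : Finset Interval) :
    ((mergedPairs (R :: Rs)).map (optIn S)).sum ≤ optIn S ⟨a, b⟩ + optIn S ⟨R.hi, b⟩ := by
  induction Rs generalizing a R with
  | nil => simp [mergedPairs]
  | cons R' Rs ih =>
    obtain ⟨h1, h2, h3⟩ := h
    have h4 := ih h3
    have h5 := optIn_add_le S (h2.trans h3.2.1) h3.2.2.leftPart_subset
    subst h1
    simp only [mergedPairs, List.map_cons, List.sum_cons]
    omega

theorem length_mergedPairs_le (Rs : List Region) : (mergedPairs Rs).length ≤ Rs.length := by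
  induction Rs with
  | nil => simp [mergedPairs]
  | cons R Rs ih =>
    cases Rs with
    | nil => simp [mergedPairs]
    | cons R' Rs => simpa [mergedPairs] using ih

/-- An element of an independent set lies within one of the regions, or it is the only one that
crosses a certain boundary between two of them. -/
theorem IsTiling.card_add_one_le {Rs : List Region} {a b : Cut} (h : IsTiling a Rs b)
    (hne : Rs ≠ []) {T : Finset Interval} (hT : Independent T)
    (hab : ∀ I ∈ T, Region.Contains ⟨a, b⟩ I) :
    T.card + 1 ≤ (Rs.map fun R => (T.filter R.Contains).card + 1).sum := by
  induction Rs generalizing a T with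
  | nil => exact absurd rfl hne
  | cons R Rs ih =>
    obtain ⟨hlo, hle, hRs⟩ := h
    rcases eq_or_ne Rs [] with rfl | hne'
    · have hb : R.hi = b := hRs
      have : T.filter R.Contains = T := Finset.filter_true_of_mem fun I hI => by
        have := hab I hI
        rwa [← hlo, ← hb] at this
      simp [this]
    · set T' := T.filter (Region.Contains ⟨R.hi, b⟩) with hT'
      have h1 := ih hRs hne' (T := T') (hT.mono (Finset.filter_subset _ _))
        (fun I hI => (Finset.mem_filter.1 hI).2)
      have h2 : (Rs.map fun R => (T'.filter R.Contains).card + 1).sum ≤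
          (Rs.map fun R => (T.filter R.Contains).card + 1).sum := by
        refine List.sum_le_sum fun S _ => ?_
        exact Nat.add_le_add_right (Finset.card_le_card
          (Finset.filter_subset_filter _ (Finset.filter_subset _ _))) 1
      -- What lies neither within `R` nor to its right crosses the cut `R.hi`.
      have hsub : T ⊆ T.filter R.Contains ∪ (T' ∪ T.filter R.hi.Crosses) := by
        intro I hI
        have h3 := Region.contains_iff.1 (hab I hI)
        simp only [hT', Finset.mem_union, Finset.mem_filter, hI, true_and, Cut.Crosses,
          Region.contains_iff, hlo]
        have h4 : I.snd ∈ b.leftPart := h3.2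
        have h5 : I.fst ∉ a.leftPart := h3.1
        tauto
      have h3 := Finset.card_le_card hsub
      have h4 := Finset.card_union_le (T.filter R.Contains) (T' ∪ T.filter R.hi.Crosses)
      have h5 := Finset.card_union_le T' (T.filter R.hi.Crosses)
      have h6 := hT.card_crosses_le_one R.hi
      simp only [List.map_cons, List.sum_cons]
      omega

/-! ### The invariant of a run -/

/-- The cell stores the leftmost and the rightmost one of the intervals of `S` that lie within its
region, and these two meet. -/
def Cell.Invariant (S : Finset Interval) (c : Cell) : Prop :=
  ∃ l r : Interval, c.stored = some (l, r) ∧ l ∈ S ∧ r ∈ S ∧ c.region.Contains l ∧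
    c.region.Contains r ∧ r.fst ≤ l.snd ∧ ∀ J ∈ S, c.region.Contains J →
      (l.snd ≤ J.snd ∧ (J.snd = l.snd → J.fst ≤ l.fst)) ∧
      (J.fst ≤ r.fst ∧ (J.fst = r.fst → r.snd ≤ J.snd))

/-- The invariant of a run that has been fed the intervals of `S`. -/
def CP.Invariant (S : Finset Interval) (P : CP) : Prop :=
  IsTiling .negInf P.regions .posInf ∧ ∀ c ∈ P, c.Invariant S

/-- The extremality of the old pair `l`, `r` leaves so few old intervals in the two halves of a
split region that one stored interval serves as both extremes in each half. The tie-breaking rule is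
what makes this work. -/
theorem Cell.Invariant.step {S : Finset Interval} {c : Cell} (h : c.Invariant S) (I : Interval) :
    (∀ d ∈ c.step I, d.Invariant (insert I S)) ∧
      IsTiling c.region.lo ((c.step I).map Cell.region) c.region.hi := by
  obtain ⟨⟨lo, hi⟩, st⟩ := c
  obtain ⟨l, r, hst, hl, hr, hcl, hcr, hrl, hJ⟩ := h
  have hle : lo.leftPart ⊆ hi.leftPart := hcl.leftPart_subset
  simp only at hst hJ hcl hcr
  subst hst
  unfold Cell.step
  split_ifs with hI
  swap
  · refine ⟨?_, rfl, hle, rfl⟩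
    simp only [List.mem_singleton, forall_eq]
    refine ⟨l, r, rfl, by simp [hl], by simp [hr], hcl, hcr, hrl, ?_⟩
    intro J hJS hJc
    rcases Finset.mem_insert.1 hJS with rfl | hJS
    · exact absurd hJc hI
    · exact hJ J hJS hJc
  simp only at hI ⊢
  have hIle := I.fst_le_snd
  have hlle := l.fst_le_snd
  have hrle := r.fst_le_snd
  have hlr := hJ l hl hcl
  have hrr := hJ r hr hcr
  by_cases hmeet : ((I : Set ℝ) ∩ (l : Set ℝ) ∩ (r : Set ℝ)).Nonempty
  · rw [if_pos hmeet]
    refine ⟨?_, rfl, hle, rfl⟩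
    simp only [List.mem_singleton, forall_eq]
    obtain ⟨x, ⟨hxI, hxl⟩, hxr⟩ := hmeet
    rw [mem_interval] at hxI hxl hxr
    have hL : newLeftmost l I = l ∨ newLeftmost l I = I := by
      unfold newLeftmost; split_ifs <;> simp
    have hR : newRightmost r I = r ∨ newRightmost r I = I := by
      unfold newRightmost; split_ifs <;> simp
    refine ⟨newLeftmost l I, newRightmost r I, rfl, ?_, ?_, ?_, ?_, ?_, ?_⟩
    · rcases hL with h | h <;> simp [h, hl]
    · rcases hR with h | h <;> simp [h, hr]
    · rcases hL with h | h <;> simp [h, hcl, hI]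
    · rcases hR with h | h <;> simp [h, hcr, hI]
    · have hL' : x ≤ (newLeftmost l I).snd := by
        rcases hL with h | h <;> rw [h] <;> linarith
      have hR' : (newRightmost r I).fst ≤ x := by
        rcases hR with h | h <;> rw [h] <;> linarith
      linarith
    · intro J hJS hJc
      have key : J = I ∨ ((l.snd ≤ J.snd ∧ (J.snd = l.snd → J.fst ≤ l.fst)) ∧
          (J.fst ≤ r.fst ∧ (J.fst = r.fst → r.snd ≤ J.snd))) := by
        rcases Finset.mem_insert.1 hJS with h | h
        · exact Or.inl h
        · exact Or.inr (hJ J h hJc)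
      constructor
      · unfold newLeftmost
        rcases key with rfl | ⟨key, -⟩
        · split_ifs with h
          · exact ⟨le_rfl, fun _ => le_rfl⟩
          · push Not at h
            exact ⟨h.1, fun h' => (h.2 h').le⟩
        · split_ifs with h
          · rcases h with h | h
            · exact ⟨by linarith, fun h' => by linarith⟩
            · exact ⟨by linarith, fun h' => (key.2 (by linarith)).trans h.2⟩
          · exact key
      · unfold newRightmost
        rcases key with rfl | ⟨-, key⟩
        · split_ifs with h
          · exact ⟨le_rfl, fun _ => le_rfl⟩
          · push Not at h
            exact ⟨h.1, fun h' => (h.2 h').le⟩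
        · split_ifs with h
          · rcases h with h | h
            · exact ⟨by linarith, fun h' => by linarith⟩
            · exact ⟨by linarith, fun h' => h.2.trans (key.2 (by linarith))⟩
          · exact key
  · rw [if_neg hmeet]
    -- Helly in dimension one: `l` and `r` meet, so if `I` met both, all three would have a common
    -- point.
    have hdisj : I.snd < r.fst ∨ l.snd < I.fst := by
      by_contra! hc
      refine hmeet ⟨max I.fst r.fst, ⟨?_, ?_⟩, ?_⟩ <;> rw [mem_interval]
      · exact ⟨le_max_left _ _, max_le hIle hc.1⟩
      · exact ⟨le_max_of_le_right hlr.2.1, max_le hc.2 hrl⟩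
      · exact ⟨le_max_right _ _, max_le (hc.2.trans hrr.1.1) hrle⟩
    rw [Region.contains_iff] at hI hcl hcr
    simp only at hI hcl hcr
    split_ifs with hsplit
    · have hlt : I.snd < r.fst := by
        rcases hdisj with h | h
        · exact h
        · linarith
      constructor
      · simp only [List.mem_cons, List.not_mem_nil, or_false, forall_eq_or_imp, forall_eq]
        constructor
        · refine ⟨I, I, rfl, by simp, by simp, ?_, ?_, hIle, ?_⟩
          · simpa [Region.contains_iff, hI.1] using hlt
          · simpa [Region.contains_iff, hI.1] using hlt
          · intro J hJS hJc
            rcases Finset.mem_insert.1 hJS with rfl | hJS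
            · exact ⟨⟨le_rfl, fun _ => le_rfl⟩, ⟨le_rfl, fun _ => le_rfl⟩⟩
            · rw [Region.contains_iff] at hJc
              have h1 : J.snd < r.fst := hJc.2
              -- An old interval in the left half would end before `r.fst ≤ l.snd`, contradicting
              -- the choice of `l`.
              have := hJ J hJS (Region.contains_iff.2
                ⟨hJc.1, hi.leftPart_lower (h1.le.trans hrle) hcr.2⟩)
              linarith [this.1.1]
        · have hc : Region.Contains ⟨.before r.fst, hi⟩ r := by
            simp [Region.contains_iff, hcr.2]
          refine ⟨r, r, rfl, by simp [hr], by simp [hr], hc, hc, hrle, ?_⟩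
          intro J hJS hJc
          rw [Region.contains_iff] at hJc
          have h1 : r.fst ≤ J.fst := by simpa using hJc.1
          rcases Finset.mem_insert.1 hJS with rfl | hJS
          · linarith
          · have h2 := hJ J hJS (Region.contains_iff.2
              ⟨fun h => hcr.1 (lo.leftPart_lower h1 h), hJc.2⟩)
            -- An old interval in the right half starts exactly where `r` does, so the tie-breaking
            -- rule makes `r` the one that ends first: `r` is also leftmost there.
            have h3 : J.fst = r.fst := le_antisymm h2.2.1 h1
            exact ⟨⟨h2.2.2 h3, fun _ => h3.le⟩, h2.2⟩
      · refine ⟨rfl, ?_, rfl, ?_, rfl⟩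
        · exact Cut.leftPart_subset_of_mem (x := I.snd)
            (fun h => hI.1 (lo.leftPart_lower hIle h)) hlt
        · exact Cut.leftPart_subset_of_mem (x := r.fst) (by simp)
            (hi.leftPart_lower hrle hcr.2)
    · have hlt : l.snd < I.fst := by
        rcases hdisj with h | h
        · exact absurd h.le hsplit
        · exact h
      constructor
      · simp only [List.mem_cons, List.not_mem_nil, or_false, forall_eq_or_imp, forall_eq]
        constructor
        · have hc : Region.Contains ⟨lo, .after l.snd⟩ l := by
            simp [Region.contains_iff, hcl.1]
          refine ⟨l, l, rfl, by simp [hl], by simp [hl], hc, hc, hlle, ?_⟩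
          intro J hJS hJc
          rw [Region.contains_iff] at hJc
          have h1 : J.snd ≤ l.snd := hJc.2
          have h0 := J.fst_le_snd
          rcases Finset.mem_insert.1 hJS with rfl | hJS
          · linarith
          · have h2 := hJ J hJS (Region.contains_iff.2
              ⟨hJc.1, hi.leftPart_lower h1 hcl.2⟩)
            have h3 : J.snd = l.snd := le_antisymm h1 h2.1.1
            exact ⟨h2.1, ⟨h2.1.2 h3, fun _ => h3.ge⟩⟩
        · have hc : Region.Contains ⟨.after l.snd, hi⟩ I := by
            simp [Region.contains_iff, hI.2, hlt]
          refine ⟨I, I, rfl, by simp, by simp, hc, hc, hIle, ?_⟩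
          intro J hJS hJc
          rcases Finset.mem_insert.1 hJS with rfl | hJS
          · exact ⟨⟨le_rfl, fun _ => le_rfl⟩, ⟨le_rfl, fun _ => le_rfl⟩⟩
          · rw [Region.contains_iff] at hJc
            have h1 : l.snd < J.fst := by simpa using hJc.1
            have := hJ J hJS (Region.contains_iff.2
              ⟨fun h => hcl.1 (lo.leftPart_lower (hlle.trans h1.le) h), hJc.2⟩)
            linarith [this.2.1]
      · refine ⟨rfl, ?_, rfl, ?_, rfl⟩
        · exact Cut.leftPart_subset_of_mem (x := l.fst) hcl.1 hlle
        · exact Cut.leftPart_subset_of_mem (x := I.snd)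
            (by simpa using hlt.trans_le hIle) hI.2

theorem CP.Invariant.step {S : Finset Interval} {P : CP} (h : P.Invariant S) (I : Interval) :
    (P.step I).Invariant (insert I S) := by
  constructor
  · obtain ⟨h1, h2⟩ := h
    simp only [CP.regions, CP.step] at h1 ⊢
    -- The induction over the cells needs an arbitrary left end of the tiling.
    generalize Cut.negInf = a at h1 ⊢
    induction P generalizing a with
    | nil => exact h1
    | cons c P ih =>
      obtain ⟨h3, -, h4⟩ := h1
      rw [List.flatMap_cons, List.map_append]
      have h5 := ((h2 c (by simp)).step I).2
      rw [h3] at h5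
      exact h5.append (ih (fun d hd => h2 d (by simp [hd])) _ h4)
  · intro d hd
    obtain ⟨c, hc, hd⟩ := List.mem_flatMap.1 hd
    exact ((h.2 c hc).step I).1 d hd

/-- The initial cell stores nothing and so violates the invariant, which can start only with the
first interval. -/
theorem CP.invariant_init_step (I : Interval) : (CP.init.step I).Invariant {I} := by
  have h : CP.init.step I = [⟨Region.line, some (I, I)⟩] := by
    simp [CP.init, CP.step, Cell.step, Region.line_contains]
  rw [h]
  refine ⟨⟨rfl, by simp [Cut.leftPart], rfl⟩, ?_⟩
  simp only [List.mem_singleton, forall_eq]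
  refine ⟨I, I, rfl, by simp, by simp, Region.line_contains I, Region.line_contains I,
    I.fst_le_snd, ?_⟩
  intro J hJ _
  rw [Finset.mem_singleton.1 hJ]
  exact ⟨⟨le_rfl, fun _ => le_rfl⟩, ⟨le_rfl, fun _ => le_rfl⟩⟩

theorem CP.Invariant.ne_nil {S : Finset Interval} {P : CP} (h : P.Invariant S) : P ≠ [] := by
  rintro rfl
  exact Cut.noConfusion (show Cut.negInf = Cut.posInf from h.1)

theorem CP.Invariant.size_eq {S : Finset Interval} {P : CP} (h : P.Invariant S) :
    P.size = P.length := by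
  have h2 := h.2
  clear h
  unfold CP.size CP.solution
  induction P with
  | nil => rfl
  | cons c P ih =>
    obtain ⟨l, r, hs, -⟩ := h2 c (by simp)
    rw [List.filterMap_cons_some (b := l) (by simp [hs]), List.length_cons, List.length_cons,
      ih fun d hd => h2 d (by simp [hd])]

theorem CP.Invariant.one_le_size {S : Finset Interval} {P : CP} (h : P.Invariant S) :
    1 ≤ P.size := by
  rw [h.size_eq]
  exact List.length_pos_of_ne_nil h.ne_nil

theorem CP.Invariant.mem_of_mem_intervals {S : Finset Interval} {P : CP} (h : P.Invariant S)
    {I : Interval} (hI : I ∈ P.intervals) : I ∈ S := by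
  obtain ⟨c, hc, hI⟩ := List.mem_flatMap.1 hI
  obtain ⟨l, r, hs, hl, hr, -⟩ := h.2 c hc
  simp only [hs, Option.toList_some, List.flatMap_cons, List.flatMap_nil, List.append_nil,
    List.mem_cons, List.not_mem_nil, or_false] at hI
  rcases hI with rfl | rfl <;> assumption

theorem CP.mem_intervals_of_mem_solution {P : CP} {I : Interval} (hI : I ∈ P.solution) :
    I ∈ P.intervals := by
  obtain ⟨c, hc, hI⟩ := List.mem_filterMap.1 hI
  obtain ⟨p, hp, rfl⟩ := Option.map_eq_some_iff.1 hI
  exact List.mem_flatMap.2 ⟨c, hc, by simp [hp]⟩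

/-- The leftmost intervals lie in different regions, so they are independent; `D` may be any set
that retains them. -/
theorem CP.Invariant.size_le_opt {S : Finset Interval} {P : CP} (h : P.Invariant S)
    {D : Finset Interval} (hD : ∀ I ∈ P.solution, I ∈ D) : P.size ≤ (opt D).card := by
  have h1 := (h.1.sum_optIn_le D).trans (optIn_le D _)
  refine le_trans ?_ h1
  have h2 : ∀ n ∈ P.regions.map (optIn D), 1 ≤ n := by
    intro n hn
    simp only [CP.regions, List.map_map, List.mem_map] at hn
    obtain ⟨c, hc, rfl⟩ := hn
    obtain ⟨l, r, hs, -, -, hl, -⟩ := h.2 c hc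
    exact one_le_optIn (hD l (List.mem_filterMap.2 ⟨c, hc, by simp [hs]⟩)) hl
  have h3 := List.card_nsmul_le_sum _ 1 h2
  rw [h.size_eq]
  simpa [CP.regions] using h3

theorem CP.Invariant.size_le_opt_self {S : Finset Interval} {P : CP} (h : P.Invariant S) :
    P.size ≤ (opt S).card :=
  h.size_le_opt fun _ hI => h.mem_of_mem_intervals (CP.mem_intervals_of_mem_solution hI)

/-- Any two intervals of the stream within the same region meet. -/
theorem CP.Invariant.card_filter_le_one {S : Finset Interval} {P : CP} (h : P.Invariant S)
    {R : Region} (hR : R ∈ P.regions) {T : Finset Interval} (hT : Independent T) (hTS : T ⊆ S) :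
    (T.filter R.Contains).card ≤ 1 := by
  obtain ⟨c, hc, rfl⟩ := List.mem_map.1 hR
  obtain ⟨l, r, hs, -, -, -, -, hrl, hJ⟩ := h.2 c hc
  rw [Finset.card_le_one]
  intro I hI J hJ'
  rw [Finset.mem_filter] at hI hJ'
  have h1 := hJ I (hTS hI.1) hI.2
  have h2 := hJ J (hTS hJ'.1) hJ'.2
  exact hT.eq_of_meet hI.1 hJ'.1 (by linarith [h1.2.1, h2.1.1]) (by linarith [h2.2.1, h1.1.1])

theorem CP.Invariant.regions_ne_nil {S : Finset Interval} {P : CP} (h : P.Invariant S) :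
    P.regions ≠ [] := by
  simpa [CP.regions] using h.ne_nil

theorem CP.Invariant.opt_add_one_le {S : Finset Interval} {P : CP} (h : P.Invariant S) :
    (opt S).card + 1 ≤ 2 * P.size := by
  refine (h.1.card_add_one_le h.regions_ne_nil (opt_independent S)
    fun I _ => Region.line_contains I).trans ?_
  have h2 : ∀ n ∈ P.regions.map (fun R => ((opt S).filter R.Contains).card + 1), n ≤ 2 := by
    intro n hn
    obtain ⟨R, hR, rfl⟩ := List.mem_map.1 hn
    have := h.card_filter_le_one hR (opt_independent S) (opt_subset S)
    omega
  have h3 := List.sum_le_card_nsmul _ 2 h2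
  rw [h.size_eq]
  simpa [CP.regions, mul_comm] using h3

/-! ### Runs restricted to a region. -/

/-- The invariant of a run restricted to its domain, when the stream consists of `S`. -/
def RestrictedRun.Invariant (S : Finset Interval) (Q : RestrictedRun) : Prop :=
  (Q.cp = CP.init ∧ ∀ I ∈ S, ¬ Q.domain.Contains I) ∨ Q.cp.Invariant (S.filter Q.domain.Contains)

theorem RestrictedRun.invariant_start (R : Region) : (RestrictedRun.start R).Invariant ∅ :=
  Or.inl ⟨rfl, by simp⟩

theorem RestrictedRun.domain_step (I : Interval) (Q : RestrictedRun) :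
    (Q.step I).domain = Q.domain := by
  unfold RestrictedRun.step
  split_ifs <;> rfl

theorem RestrictedRun.Invariant.step {S : Finset Interval} {Q : RestrictedRun}
    (h : Q.Invariant S) (I : Interval) : (Q.step I).Invariant (insert I S) := by
  unfold RestrictedRun.Invariant
  rw [RestrictedRun.domain_step]
  unfold RestrictedRun.step
  split_ifs with hI
  · right
    rw [Finset.filter_insert, if_pos hI]
    rcases h with ⟨h1, h2⟩ | h
    · rw [Finset.filter_false_of_mem h2, h1]
      exact CP.invariant_init_step I
    · exact h.step I
  · rcases h with ⟨h1, h2⟩ | h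
    · refine Or.inl ⟨h1, ?_⟩
      simpa [hI] using h2
    · right
      rwa [Finset.filter_insert, if_neg hI]

theorem RestrictedRun.Invariant.words_le {S : Finset Interval} {Q : RestrictedRun}
    (h : Q.Invariant S) : Q.words ≤ 6 + 4 * optIn S Q.domain := by
  unfold RestrictedRun.words CP.words
  rcases h with ⟨h, -⟩ | h
  · simp [h, CP.init]
  · have := h.size_le_opt_self
    rw [h.size_eq] at this
    unfold optIn
    omega

theorem RestrictedRun.Invariant.mem {S : Finset Interval} {Q : RestrictedRun}
    (h : Q.Invariant S) {I : Interval} (hI : I ∈ Q.cp.intervals) :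
    I ∈ S ∧ Q.domain.Contains I := by
  rcases h with ⟨h, -⟩ | h
  · simp [h, CP.init, CP.intervals] at hI
  · simpa using h.mem_of_mem_intervals hI

/-- The factor 2 of a run, applied inside the domain. The unit gained over a plain factor 2 whenever
something was seen becomes the term `k` of the combination bound. -/
theorem RestrictedRun.Invariant.optIn_le {S : Finset Interval} {Q : RestrictedRun}
    (h : Q.Invariant S) {D : Finset Interval} (hD : ∀ I ∈ Q.cp.intervals, I ∈ D) :
    optIn S Q.domain = 0 ∨ optIn S Q.domain + 1 ≤ 2 * optIn D Q.domain := by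
  have hmem := fun I => h.mem (I := I)
  rcases h with ⟨-, h⟩ | h
  · left
    have := opt_subset (S.filter Q.domain.Contains)
    rw [Finset.filter_false_of_mem h] at this
    unfold optIn
    rw [Finset.filter_false_of_mem h, Finset.subset_empty.1 this, Finset.card_empty]
  · right
    have h1 := h.opt_add_one_le
    have h2 : Q.cp.size ≤ optIn D Q.domain := h.size_le_opt fun I hI => by
      have hI' := CP.mem_intervals_of_mem_solution hI
      simpa using ⟨hD I hI', (hmem I hI').2⟩
    unfold optIn at h2 ⊢
    omega

/-! ### The invariant of the smooth histogram -/

/-- The items of the stream from position `a` on, before position `b`. -/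
noncomputable def items (σ : ℕ → Interval) (a b : ℕ) : Finset Interval := (Finset.Ico a b).image σ

theorem items_succ (σ : ℕ → Interval) {a b : ℕ} (h : a ≤ b) :
    items σ a (b + 1) = insert (σ b) (items σ a b) := by
  rw [items, items, ← Finset.insert_Ico_right_eq_Ico_add_one h, Finset.image_insert]

theorem items_self (σ : ℕ → Interval) (a : ℕ) : items σ a a = ∅ := by
  simp [items]

theorem items_subset (σ : ℕ → Interval) {a b a' b' : ℕ} (ha : a' ≤ a) (hb : b ≤ b') :
    items σ a b ⊆ items σ a' b' :=
  Finset.image_subset_image (Finset.Ico_subset_Ico ha hb)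

theorem items_union (σ : ℕ → Interval) {a b c : ℕ} (hab : a ≤ b) (hbc : b ≤ c) :
    items σ a b ∪ items σ b c = items σ a c := by
  rw [items, items, ← Finset.image_union, Finset.Ico_union_Ico_eq_Ico hab hbc, items]

/-- After `t` items, the main part of the run is what it should be. -/
def Run.Valid (σ : ℕ → Interval) (t : ℕ) (r : Run) : Prop :=
  1 ≤ r.age ∧ r.age ≤ t ∧ r.cp.Invariant (items σ (t - r.age) t)

/-- After `t` items, the associated part of the run `r` is what it should be, when its predecessor
started with the item number `a`: the two became adjacent after `u` items, when the memory of the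
predecessor was `P` and that of `r` was `Q`. -/
def Run.Linked (β : ℝ) (σ : ℕ → Interval) (t a : ℕ) (r : Run) : Prop :=
  a < t - r.age ∧ ∃ u, t - r.age < u ∧ u ≤ t ∧ ∃ P Q : CP, P.Invariant (items σ a u) ∧
    Q.Invariant (items σ (t - r.age) u) ∧ r.snapshot = Q.solution ∧
    r.singles.map RestrictedRun.domain = P.regions ∧
    r.pairs.map RestrictedRun.domain = mergedPairs P.regions ∧
    (∀ S ∈ r.singles, S.Invariant (items σ u t)) ∧ (∀ S ∈ r.pairs, S.Invariant (items σ u t)) ∧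
    ((a + 1 = t - r.age ∧ P.size ≤ 2) ∨ (P.size : ℝ) ≤ (1 + β) * (Q.size : ℝ))

/-- The runs `rs` are those younger than the run `p`. -/
def Chained (β : ℝ) (σ : ℕ → Interval) (t : ℕ) : Run → List Run → Prop
  | p, [] => p.age = 1
  | p, r :: rs => r.Valid σ t ∧ r.Linked β σ t (t - p.age) ∧ Chained β σ t r rs

/-- The older run enters only through its starting time, so replacing its associated data does not
disturb the younger ones. -/
theorem Chained.congr {β : ℝ} {σ : ℕ → Interval} {t : ℕ} {p q : Run} {rs : List Run}
    (h : Chained β σ t p rs) (hpq : q.age = p.age) : Chained β σ t q rs := by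
  cases rs with
  | nil => exact hpq.trans h
  | cons r rs => rw [Chained, hpq]; exact h

theorem Run.Valid.feed {σ : ℕ → Interval} {t : ℕ} {r : Run} (h : r.Valid σ t) :
    (r.feed (σ t)).Valid σ (t + 1) := by
  obtain ⟨h1, h2, h3⟩ := h
  refine ⟨by simp [Run.feed], by simpa [Run.feed] using h2, ?_⟩
  simp only [Run.feed, Nat.add_sub_add_right]
  rw [items_succ σ (Nat.sub_le t r.age)]
  exact h3.step (σ t)

theorem map_domain_map_step (I : Interval) (Qs : List RestrictedRun) :
    (Qs.map (RestrictedRun.step I)).map RestrictedRun.domain = Qs.map RestrictedRun.domain := by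
  rw [List.map_map]
  exact List.map_congr_left fun Q _ => Q.domain_step I

theorem Run.Linked.feed {β : ℝ} {σ : ℕ → Interval} {t a : ℕ} {r : Run} (h : r.Linked β σ t a) :
    (r.feed (σ t)).Linked β σ (t + 1) a := by
  obtain ⟨h1, u, h2, h3, P, Q, h4, h5, h6, h7, h8, h9, h10, h11⟩ := h
  simp only [Run.Linked, Run.feed, Nat.add_sub_add_right, map_domain_map_step]
  refine ⟨h1, u, h2, by omega, P, Q, h4, h5, h6, h7, h8, ?_, ?_, h11⟩
  all_goals
    intro S hS
    obtain ⟨T, hT, rfl⟩ := List.mem_map.1 hS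
    rw [items_succ σ h3]
  · exact (h9 T hT).step _
  · exact (h10 T hT).step _

theorem Run.becomeAdjacent_linked {β : ℝ} {σ : ℕ → Interval} {t : ℕ} {p r : Run}
    (hp : p.Valid σ t) (hr : r.Valid σ t) (hpr : t - p.age < t - r.age)
    (h : (t - p.age + 1 = t - r.age ∧ p.size ≤ 2) ∨ (p.size : ℝ) ≤ (1 + β) * (r.size : ℝ)) :
    (p.becomeAdjacent r).Linked β σ t (t - p.age) := by
  have hr1 := hr.1
  have hr2 := hr.2.1
  have hstart : ∀ (Rs : List Region),
      (Rs.map RestrictedRun.start).map RestrictedRun.domain = Rs := by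
    intro Rs
    rw [List.map_map]
    exact List.map_id _
  -- The moment of adjacency is `u = t`: the fresh restricted runs have seen the empty set of items.
  refine ⟨hpr, t, by simp only [Run.becomeAdjacent]; omega, le_rfl, p.cp, r.cp, hp.2.2, hr.2.2,
    rfl, hstart _, hstart _, ?_, ?_, h⟩
  all_goals
    intro S hS
    obtain ⟨R, -, rfl⟩ := List.mem_map.1 hS
    rw [items_self]
    exact RestrictedRun.invariant_start R

theorem Run.valid_start_feed (σ : ℕ → Interval) (t : ℕ) :
    (Run.start.feed (σ t)).Valid σ (t + 1) := by
  refine ⟨by simp [Run.feed], by simp [Run.feed, Run.start], ?_⟩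
  simp only [Run.feed, Run.start, Nat.add_sub_add_right, Nat.sub_zero]
  rw [items_succ σ le_rfl, items_self]
  exact CP.invariant_init_step (σ t)

theorem card_opt_items_le (σ : ℕ → Interval) (a b : ℕ) : (opt (items σ a b)).card ≤ b - a := by
  refine (Finset.card_le_card (opt_subset _)).trans (Finset.card_image_le.trans ?_)
  simp

theorem Run.Valid.size_le_age {σ : ℕ → Interval} {t : ℕ} {r : Run} (h : r.Valid σ t) :
    r.size ≤ r.age := by
  have h1 := h.2.2.size_le_opt_self.trans (card_opt_items_le σ _ _)
  have h2 := h.2.1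
  unfold Run.size
  omega

/-- The youngest run has age 1, hence age 2 and size at most 2 after being fed, and the new run
starts one item later. This is the consecutive alternative in `Run.Linked`; no size comparison is
needed. -/
theorem Chained.insertNew {β : ℝ} {σ : ℕ → Interval} {t : ℕ} {p : Run} {rs : List Run}
    (hp : p.Valid σ t) (h : Chained β σ t p rs) :
    ∃ rs', insertNew ((p :: rs).map (Run.feed (σ t))) (Run.start.feed (σ t)) =
      p.feed (σ t) :: rs' ∧ Chained β σ (t + 1) (p.feed (σ t)) rs' := by
  induction rs generalizing p with
  | nil =>
    have hage : p.age = 1 := h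
    have hnew := Run.valid_start_feed σ t
    have hle : (p.feed (σ t)).size ≤ 2 := by
      have := hp.feed.size_le_age
      simpa [Run.feed, hage] using this
    have ht := hp.2.1
    refine ⟨[(p.feed (σ t)).becomeAdjacent (Run.start.feed (σ t))],
      by simp [IntervalSelection.insertNew], hnew, ?_, rfl⟩
    refine Run.becomeAdjacent_linked hp.feed hnew ?_ (Or.inl ⟨?_, hle⟩) <;>
      simp only [Run.feed, Run.start, hage] <;> omega
  | cons r rs ih =>
    obtain ⟨h1, h2, h3⟩ := h
    obtain ⟨rs', h4, h5⟩ := ih h1 h3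
    refine ⟨r.feed (σ t) :: rs', ?_, h1.feed, ?_, h5⟩
    · rw [← h4]
      unfold IntervalSelection.insertNew
      rw [List.map_cons, List.map_cons, List.getLast?_cons_cons]
      obtain ⟨q, hq⟩ : ∃ q, (r.feed (σ t) :: rs.map (Run.feed (σ t))).getLast? = some q :=
        Option.isSome_iff_exists.1 (by simp)
      rw [hq]
      rfl
    · have := h2.feed
      simpa [Run.feed] using this

/-! ### The clean-up of the smooth histogram. -/

theorem dropBeforeLast_spec {α : Type} (p : α → Prop) (as : List α) (h : as ≠ []) :
    ∃ bs c cs, as = bs ++ c :: cs ∧ dropBeforeLast p as = c :: cs ∧ (bs ≠ [] → p c) ∧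
      ∀ x ∈ cs, ¬ p x := by
  induction as with
  | nil => exact absurd rfl h
  | cons a as ih =>
    unfold dropBeforeLast
    split_ifs with hp
    · obtain ⟨x, hx, hpx⟩ := hp
      obtain ⟨bs, c, cs, h1, h2, h3, h4⟩ := ih (List.ne_nil_of_mem hx)
      refine ⟨a :: bs, c, cs, by simp [h1], h2, fun _ => ?_, h4⟩
      rcases eq_or_ne bs [] with rfl | hbs
      · rw [h1] at hx
        rcases List.mem_cons.1 hx with rfl | hx
        · exact hpx
        · exact absurd hpx (h4 x hx)
      · exact h3 hbs
    · push Not at hp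
      exact ⟨[], a, as, rfl, rfl, fun h => absurd rfl h, hp⟩

theorem Chained.of_append {β : ℝ} {σ : ℕ → Interval} {t : ℕ} {p q : Run} {bs qs : List Run}
    (h : Chained β σ t p (bs ++ q :: qs)) :
    q.Valid σ t ∧ t - p.age < t - q.age ∧ Chained β σ t q qs := by
  induction bs generalizing p with
  | nil => exact ⟨h.1, h.2.1.1, h.2.2⟩
  | cons r bs ih =>
    obtain ⟨h1, h2, h3⟩ := ih h.2.2
    exact ⟨h1, h.2.1.1.trans h2, h3⟩

/-- If something is deleted, the surviving neighbour `q` passed the size test, which is what linking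
it to `p` requires. Beyond `q` the test fails, so only `qs` is known to be small. Sizes are tracked
instead of membership because `q` may have received new associated data. -/
theorem Chained.prune {β : ℝ} {σ : ℕ → Interval} {t : ℕ} {p : Run} {rs : List Run}
    (hp : p.Valid σ t) (h : Chained β σ t p rs) (hne : rs ≠ []) :
    ∃ q qs, prune β p rs = q :: qs ∧ Chained β σ t p (q :: qs) ∧
      (∀ x ∈ q :: qs, ∃ y ∈ rs, x.size = y.size) ∧
      ∀ x ∈ qs, (1 + β) * (x.size : ℝ) < (p.size : ℝ) := by
  obtain ⟨bs, q, qs, h1, h2, h3, h4⟩ := dropBeforeLast_spec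
    (fun q : Run => (p.size : ℝ) ≤ (1 + β) * (q.size : ℝ)) rs hne
  unfold IntervalSelection.prune
  rw [h2]
  subst h1
  simp only
  split_ifs with hlen
  · have hbs : bs ≠ [] := by
      rintro rfl
      simp at hlen
    obtain ⟨h5, h6, h7⟩ := h.of_append
    refine ⟨_, _, rfl, ⟨h5, Run.becomeAdjacent_linked hp h5 h6 (Or.inr (h3 hbs)), h7.congr rfl⟩,
      ?_, fun x hx => not_le.1 (h4 x hx)⟩
    intro x hx
    rcases List.mem_cons.1 hx with rfl | hx
    · exact ⟨q, by simp, rfl⟩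
    · exact ⟨x, by simp [hx], rfl⟩
  · have hbs : bs = [] := by
      simp only [List.length_append, List.length_cons, not_lt] at hlen
      exact List.eq_nil_of_length_eq_zero (by omega)
    subst hbs
    exact ⟨_, _, rfl, h, fun x hx => ⟨x, hx, rfl⟩, fun x hx => not_le.1 (h4 x hx)⟩

/-- Every run is larger by a factor of more than `1 + β` than the one after the next, and all
following ones. -/
def Sparse (β : ℝ) : List Run → Prop
  | [] => True
  | p :: rs => (∀ x ∈ rs.tail, (1 + β) * (x.size : ℝ) < (p.size : ℝ)) ∧ Sparse β rs

/-- Later pruning only deletes runs or renews associated data, so the size gap established for the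
head persists. -/
theorem Chained.cleanUp {β : ℝ} {σ : ℕ → Interval} {t : ℕ} {p : Run} {rs : List Run}
    (hp : p.Valid σ t) (h : Chained β σ t p rs) :
    ∃ rs', cleanUp β (p :: rs) = p :: rs' ∧ Chained β σ t p rs' ∧ Sparse β (p :: rs') ∧
      ∀ x ∈ rs', ∃ y ∈ rs, x.size = y.size := by
  induction hn : rs.length using Nat.strong_induction_on generalizing p rs with
  | _ n ih =>
  rw [IntervalSelection.cleanUp]
  rcases eq_or_ne rs [] with rfl | hne
  · refine ⟨[], ?_, h, by simp [Sparse], by simp⟩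
    simp [IntervalSelection.prune, dropBeforeLast, IntervalSelection.cleanUp]
  · obtain ⟨q, qs, h1, h2, h3, h4⟩ := h.prune hp hne
    have hlen := length_prune_le β p rs
    rw [h1, List.length_cons] at hlen
    obtain ⟨rs', h5, h6, h7, h8⟩ := ih qs.length (by omega) h2.1 h2.2.2 rfl
    rw [h1, h5]
    refine ⟨_, rfl, ⟨h2.1, h2.2.1, h6⟩, ⟨?_, h7⟩, ?_⟩
    · intro x hx
      obtain ⟨y, hy, hxy⟩ := h8 x hx
      rw [hxy]
      exact h4 y hy
    · intro x hx
      rcases List.mem_cons.1 hx with rfl | hx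
      · exact h3 x (by simp)
      · obtain ⟨y, hy, hxy⟩ := h8 x hx
        rw [hxy]
        exact h3 y (by simp [hy])

/-! ### Expiry and the memory state. -/

/-- The oldest run covers the whole stream, or it had a predecessor, which has expired. -/
def Run.IsOldest (β : ℝ) (σ : ℕ → Interval) (L t : ℕ) (r : Run) : Prop :=
  (r.age = t ∧ r.snapshot = [] ∧ r.singles = [] ∧ r.pairs = []) ∨
    ∃ a, a + L < t ∧ r.Linked β σ t a

theorem Run.IsOldest.feed {β : ℝ} {σ : ℕ → Interval} {L t : ℕ} {r : Run}
    (h : r.IsOldest β σ L t) : (r.feed (σ t)).IsOldest β σ L (t + 1) := by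
  rcases h with ⟨h1, h2, h3, h4⟩ | ⟨a, h1, h2⟩
  · exact Or.inl (by simp [Run.feed, h1, h2, h3, h4])
  · exact Or.inr ⟨a, by omega, h2.feed⟩

/-- The invariant of the memory state of the algorithm. -/
def StateInvariant (β : ℝ) (σ : ℕ → Interval) (L t : ℕ) (rs : List Run) : Prop :=
  ∃ p rs', rs = p :: rs' ∧ p.Valid σ t ∧ p.age ≤ L ∧ p.IsOldest β σ L t ∧
    Chained β σ t p rs' ∧ Sparse β rs

/-- Stated from the first item on, since the initial memory has no oldest run. -/
theorem stateInvariant (β : ℝ) (σ : ℕ → Interval) {L : ℕ} (hL : 1 ≤ L) (t : ℕ) :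
    StateInvariant β σ L (t + 1) ((slidingWindowAlgorithm β L).stateAt σ (t + 1)) := by
  have key : ∀ (t : ℕ) (p : Run) (rs : List Run), p.Valid σ t → p.age ≤ L →
      p.IsOldest β σ L t → Chained β σ t p rs → StateInvariant β σ L t (cleanUp β (p :: rs)) := by
    intro t p rs h1 h2 h3 h4
    obtain ⟨rs', h5, h6, h7, -⟩ := h4.cleanUp h1
    rw [h5]
    exact ⟨p, rs', rfl, h1, h2, h3, h6, h7⟩
  induction t with
  | zero =>
    have hnew := Run.valid_start_feed σ 0
    have : (slidingWindowAlgorithm β L).stateAt σ (0 + 1) =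
        cleanUp β [Run.start.feed (σ 0)] := by
      simp [StreamAlgorithm.stateAt, slidingWindowAlgorithm, insertNew, removeExpired, Run.feed,
        Run.start, Nat.ne_of_gt hL]
    rw [this]
    exact key _ _ _ hnew hL (Or.inl ⟨rfl, rfl, rfl, rfl⟩) rfl
  | succ t ih =>
    obtain ⟨p, rs, h1, h2, h3, h4, h5, -⟩ := ih
    obtain ⟨rs', h6, h7⟩ := h5.insertNew h2
    have : (slidingWindowAlgorithm β L).stateAt σ (t + 1 + 1) = cleanUp β (removeExpired L
        (p.feed (σ (t + 1)) :: rs')) := by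
      rw [← h6, ← h1]
      rfl
    rw [this]
    rw [removeExpired]
    have h8 := h2.feed
    split_ifs with hage
    · have hage' : (p.feed (σ (t + 1))).age = L + 1 := by
        simp only [Run.feed] at hage ⊢
        omega
      cases rs' with
      | nil =>
        have : (p.feed (σ (t + 1))).age = 1 := h7
        omega
      | cons r rs' =>
        have h9 := h7.2.1.1
        have h10 := h7.1.2.1
        have h11 := h8.2.1
        exact key _ _ _ h7.1 (by omega) (Or.inr ⟨_, by omega, h7.2.1⟩) h7.2.2
    · exact key _ _ _ h8 (not_lt.1 hage) h4.feed h7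

/-! ### The approximation factor -/

theorem window_eq_items (σ : ℕ → Interval) (L t : ℕ) : window σ L t = items σ (t - L) t := rfl

theorem card_le_sum_card_filter {α ι : Type*} (T : Finset α) (l : List ι) (p : ι → α → Prop)
    (h : ∀ x ∈ T, ∃ i ∈ l, p i x) : T.card ≤ (l.map fun i => (T.filter (p i)).card).sum := by
  induction l generalizing T with
  | nil =>
    have hT : T = ∅ := Finset.eq_empty_of_forall_notMem fun x hx => by simpa using h x hx
    simp [hT]
  | cons i l ih =>
    have h1 := ih (T.filter fun x => ¬ p i x) fun x hx => by
      rw [Finset.mem_filter] at hx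
      obtain ⟨j, hj, hjx⟩ := h x hx.1
      rcases List.mem_cons.1 hj with rfl | hj
      · exact absurd hjx hx.2
      · exact ⟨j, hj, hjx⟩
    have h2 : (l.map fun j => ((T.filter fun x => ¬ p i x).filter (p j)).card).sum ≤
        (l.map fun j => (T.filter (p j)).card).sum :=
      List.sum_le_sum fun j _ => Finset.card_le_card
        (Finset.filter_subset_filter _ (Finset.filter_subset _ _))
    have h3 := Finset.card_filter_add_card_filter_not (s := T) (p i)
    simp only [List.map_cons, List.sum_cons]
    omega

/-- Combining solutions within the regions of a run `P` on `X` with an independent subset of `X`.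
Here `n` is the total size of the former, and they are nonempty in `k` of the regions. -/
theorem CP.Invariant.exists_combination {P : CP} {X Z D D' S O : Finset Interval}
    (hP : P.Invariant X) (hS : Independent S) (hSX : S ⊆ X) (hSD : S ⊆ D) (hD' : D' ⊆ D)
    (hDZ : D' ⊆ Z) (hZ : ∀ R ∈ P.regions, optIn Z R = 0 ∨ optIn Z R + 1 ≤ 2 * optIn D' R)
    (hO : Independent O) (hOXZ : O ⊆ X ∪ Z) :
    ∃ n k : ℕ, O.card + k ≤ 2 * n + 2 * P.size ∧ n ≤ (opt D).card ∧
      S.card + n ≤ (opt D).card + 3 * k := by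
  obtain ⟨U, hU, hind, hin, hcard⟩ := hP.1.exists_independent D'
  have hUD' : ∀ I ∈ U, I ∈ D' := fun I hI => (Finset.mem_filter.1 (hU hI)).1
  refine ⟨(P.regions.map (optIn D')).sum,
    (P.regions.map fun R => if 1 ≤ optIn D' R then 1 else 0).sum, ?_, ?_, ?_⟩
  · have h1 := hP.1.card_add_one_le hP.regions_ne_nil hO fun I _ => Region.line_contains I
    -- Region by region: at most one element of `O` comes from `X`, and those from `Z` number at
    -- most `2 * optIn D' R - 1`, or 0 if nothing was found.
    have h2 : (P.regions.map fun R => ((O.filter R.Contains).card + 1) +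
        (if 1 ≤ optIn D' R then 1 else 0)).sum ≤
        (P.regions.map fun R => 2 * optIn D' R + 2).sum := by
      refine List.sum_le_sum fun R hR => ?_
      have h3 := hP.card_filter_le_one hR (T := O ∩ X) (hO.mono Finset.inter_subset_left)
        Finset.inter_subset_right
      have h4 : ((O ∩ Z).filter R.Contains).card ≤ optIn Z R :=
        (hO.mono ((Finset.filter_subset _ _).trans Finset.inter_subset_left)).card_le_opt
          (Finset.filter_subset_filter _ Finset.inter_subset_right)
      have h5 : O.filter R.Contains ⊆
          (O ∩ X).filter R.Contains ∪ (O ∩ Z).filter R.Contains := by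
        rw [← Finset.filter_union, ← Finset.inter_union_distrib_left]
        exact Finset.filter_subset_filter _ (Finset.subset_inter subset_rfl hOXZ)
      have h6 := (Finset.card_le_card h5).trans (Finset.card_union_le _ _)
      have h7 := optIn_mono hDZ R
      rcases hZ R hR with h8 | h8 <;> split_ifs with h9 <;> omega
    rw [List.sum_map_add, List.sum_map_add, List.sum_map_add, List.sum_map_mul_left] at h2
    rw [List.sum_map_add] at h1
    have h3 : P.regions.length = P.size := by
      rw [hP.size_eq, CP.regions, List.length_map]
    simp only [List.map_const', List.sum_replicate, h3, smul_eq_mul] at h1 h2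
    omega
  · exact hcard.trans (hind.card_le_opt fun I hI => hD' (hUD' I hI))
  · set K := S.filter fun J : Interval => ∃ I ∈ U, ¬ Disjoint (J : Set ℝ) (I : Set ℝ) with hK
    have h1 : K.card ≤ (P.regions.map fun R => 3 * (if 1 ≤ optIn D' R then 1 else 0)).sum := by
      refine (card_le_sum_card_filter K P.regions (fun R J => 1 ≤ optIn D' R ∧
        ∃ I : Interval, R.Contains I ∧ ¬ Disjoint (J : Set ℝ) (I : Set ℝ)) ?_).trans ?_
      · intro J hJ
        obtain ⟨-, I, hI, hIJ⟩ := Finset.mem_filter.1 hJ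
        obtain ⟨R, hR, hRI⟩ := hin I hI
        exact ⟨R, hR, one_le_optIn (hUD' I hI) hRI, I, hRI, hIJ⟩
      · refine List.sum_le_sum fun R hR => ?_
        split_ifs with h
        · simp only [h, true_and]
          have hKS := hS.mono (Finset.filter_subset _ S : K ⊆ S)
          exact hKS.card_meeting_le_three R (hP.card_filter_le_one hR hKS
            ((Finset.filter_subset _ _).trans hSX))
        · simp [h]
    rw [List.sum_map_mul_left] at h1
    set S' := S.filter fun J : Interval => ¬ ∃ I ∈ U, ¬ Disjoint (J : Set ℝ) (I : Set ℝ)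
      with hS'
    have h2 : K.card + S'.card = S.card := by
      rw [hK, hS']
      convert Finset.card_filter_add_card_filter_not (s := S) _
    have hS'S : S' ⊆ S := Finset.filter_subset _ _
    obtain ⟨h3, h4⟩ := (hS.mono hS'S).union hind (by
      intro J hJ I hI
      by_contra hJI
      exact (Finset.mem_filter.1 hJ).2 ⟨I, hI, hJI⟩)
    have h5 := h3.card_le_opt (S := D) (Finset.union_subset
      (hS'S.trans hSD) fun I hI => hD' (hUD' I hI))
    omega

theorem Run.mem_intervals {r : Run} {I : Interval} :
    I ∈ r.intervals ↔ I ∈ r.cp.intervals ∨ I ∈ r.snapshot ∨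
      (∃ Q ∈ r.singles, I ∈ Q.cp.intervals) ∨ ∃ Q ∈ r.pairs, I ∈ Q.cp.intervals := by
  simp [Run.intervals]

theorem Run.Valid.opt_items_le {σ : ℕ → Interval} {t : ℕ} {r : Run} (h : r.Valid σ t) :
    (opt (items σ (t - r.age) t)).card ≤ 2 * (opt r.intervals.toFinset).card := by
  have h1 := h.2.2.opt_add_one_le
  have h2 := h.2.2.size_le_opt (D := r.intervals.toFinset) fun I hI => by
    rw [List.mem_toFinset, Run.mem_intervals]
    exact Or.inl (CP.mem_intervals_of_mem_solution hI)
  omega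

/-- The predecessor started before `w`, so what it had read before adjacency, together with
everything since, contains all items from `w` on. -/
theorem Run.Linked.opt_items_le {β : ℝ} (hβ : 0 < β) {σ : ℕ → Interval} {t a w : ℕ} {r : Run}
    (h : r.Linked β σ t a) (haw : a < w) (hw : w ≤ t - r.age) (hr : r.Valid σ t) :
    ((opt (items σ w t)).card : ℝ) ≤ (11 / 3 + 4 * β) * ((opt r.intervals.toFinset).card : ℝ) := by
  set D := r.intervals.toFinset with hD
  obtain ⟨-, u, h2, h3, P, Q, h4, h5, h6, h7, -, h9, -, h11⟩ := h
  rcases h11 with ⟨h11, -⟩ | h11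
  · have h12 : w = t - r.age := by omega
    have h13 : ((opt (items σ w t)).card : ℝ) ≤ 2 * ((opt D).card : ℝ) := by
      rw [h12]
      exact_mod_cast hr.opt_items_le
    have : (0 : ℝ) ≤ ((opt D).card : ℝ) := Nat.cast_nonneg _
    nlinarith
  · have hmem : ∀ I, I ∈ D ↔ I ∈ r.cp.intervals ∨ I ∈ r.snapshot ∨
        (∃ Q ∈ r.singles, I ∈ Q.cp.intervals) ∨ ∃ Q ∈ r.pairs, I ∈ Q.cp.intervals := fun I => by
      rw [hD, List.mem_toFinset, Run.mem_intervals]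
    set D' := (r.singles.flatMap fun S => S.cp.intervals).toFinset with hD'
    have hmem' : ∀ I, I ∈ D' ↔ ∃ Q ∈ r.singles, I ∈ Q.cp.intervals := fun I => by
      rw [hD', List.mem_toFinset, List.mem_flatMap]
    set S := opt Q.solution.toFinset with hS
    have hSQ : ∀ I ∈ S, I ∈ Q.solution := fun I hI => by simpa using opt_subset _ hI
    obtain ⟨n, k, h12, h13, h14⟩ := h4.exists_combination (S := S) (D := D) (D' := D')
      (Z := items σ u t) (opt_independent _)
      (fun I hI => items_subset σ (by omega) le_rfl
        (h5.mem_of_mem_intervals (CP.mem_intervals_of_mem_solution (hSQ I hI))))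
      (fun I hI => (hmem I).2 (Or.inr (Or.inl (h6 ▸ hSQ I hI))))
      (fun I hI => (hmem I).2 (Or.inr (Or.inr (Or.inl ((hmem' I).1 hI)))))
      (fun I hI => by
        obtain ⟨T, hT, hIT⟩ := (hmem' I).1 hI
        exact ((h9 T hT).mem hIT).1)
      (fun R hR => by
        rw [← h7] at hR
        obtain ⟨T, hT, rfl⟩ := List.mem_map.1 hR
        exact (h9 T hT).optIn_le fun I hI => (hmem' I).2 ⟨T, hT, hI⟩)
      (opt_independent (items σ w t))
      (by
        rw [items_union σ (by omega) h3]
        exact (opt_subset _).trans (items_subset σ haw.le le_rfl))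
    have h15 : Q.size ≤ S.card := h5.size_le_opt fun I hI => by simpa using hI
    have h16 : S.card ≤ (opt D).card := (opt_independent _).card_le_opt
      fun I hI => (hmem I).2 (Or.inr (Or.inl (h6 ▸ hSQ I hI)))
    have h17 : (P.size : ℝ) ≤ (1 + β) * (S.card : ℝ) :=
      h11.trans (mul_le_mul_of_nonneg_left (by exact_mod_cast h15) (by linarith))
    have h18 : (S.card : ℝ) ≤ ((opt D).card : ℝ) := by exact_mod_cast h16
    have h19 : ((opt (items σ w t)).card : ℝ) + k ≤ 2 * n + 2 * P.size := by exact_mod_cast h12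
    have h20 : (n : ℝ) ≤ ((opt D).card : ℝ) := by exact_mod_cast h13
    have h21 : (S.card : ℝ) + n ≤ ((opt D).card : ℝ) + 3 * k := by exact_mod_cast h14
    have h22 : β * (S.card : ℝ) ≤ β * ((opt D).card : ℝ) := mul_le_mul_of_nonneg_left h18 hβ.le
    have h23 : 0 ≤ β * ((opt D).card : ℝ) := by positivity
    -- Write p, s, d for the sizes of `P`, `S`, `opt D`. If p ≤ 3k, then 2n + 2p - k ≤ 2d + (5/3)p.
    -- Otherwise n ≤ d - s + 3k and 5k < (5/3)p give at most 2d - 2s + (11/3)p. With p ≤ (1 + β)s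
    -- and s ≤ d, both are at most (11/3)(1 + β)d, and 11/3 ≤ 4.
    rcases le_or_gt (P.size : ℝ) (3 * k) with h24 | h24 <;> linarith

theorem Run.Valid.mem_items {β : ℝ} {σ : ℕ → Interval} {L t : ℕ} {r : Run} (hr : r.Valid σ t)
    (h : r.IsOldest β σ L t) {I : Interval} (hI : I ∈ r.intervals) :
    I ∈ items σ (t - r.age) t := by
  rw [Run.mem_intervals] at hI
  rcases hI with hI | hI
  · exact hr.2.2.mem_of_mem_intervals hI
  · rcases h with ⟨-, h1, h2, h3⟩ | ⟨a, -, -, u, h2, h3, P, Q, -, h5, h6, -, -, h9, h10, -⟩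
    · simp [h1, h2, h3] at hI
    · rcases hI with hI | ⟨S, hS, hI⟩ | ⟨S, hS, hI⟩
      · rw [h6] at hI
        exact items_subset σ le_rfl h3
          (h5.mem_of_mem_intervals (CP.mem_intervals_of_mem_solution hI))
      · exact items_subset σ h2.le le_rfl ((h9 S hS).mem hI).1
      · exact items_subset σ h2.le le_rfl ((h10 S hS).mem hI).1

theorem isSlidingWindowApprox {β : ℝ} (hβ : 0 < β) {L : ℕ} (hL : 1 ≤ L) :
    (slidingWindowAlgorithm β L).IsSlidingWindowApprox L (11 / 3 + 4 * β) := by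
  intro σ t
  cases t with
  | zero =>
    have h : opt (window σ L 0) = ∅ := by
      have hw : window σ L 0 = ∅ := by simp [window]
      rw [hw]
      exact Finset.subset_empty.1 (opt_subset ∅)
    rw [h]
    exact ⟨Finset.empty_subset _, independent_empty, by
      simp [StreamAlgorithm.stateAt, slidingWindowAlgorithm]⟩
  | succ t =>
    obtain ⟨p, rs, h1, h2, h3, h4, -, -⟩ := stateInvariant β σ hL t
    have h5 : (slidingWindowAlgorithm β L).output
        ((slidingWindowAlgorithm β L).stateAt σ (t + 1)) = opt p.intervals.toFinset := by
      rw [h1]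
      rfl
    rw [h5, window_eq_items]
    have h6 := h2.2.1
    refine ⟨fun I hI => ?_, opt_independent _, ?_⟩
    · have := opt_subset _ hI
      rw [List.mem_toFinset] at this
      exact items_subset σ (by omega) le_rfl (h2.mem_items h4 this)
    · rcases h4 with ⟨h7, -⟩ | ⟨a, h7, h8⟩
      · have h9 : t + 1 - L = t + 1 - p.age := by omega
        have h10 : ((opt (items σ (t + 1 - L) (t + 1))).card : ℝ) ≤
            2 * ((opt p.intervals.toFinset).card : ℝ) := by
          rw [h9]
          exact_mod_cast h2.opt_items_le
        have : (0 : ℝ) ≤ ((opt p.intervals.toFinset).card : ℝ) := Nat.cast_nonneg _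
        nlinarith
      · exact h8.opt_items_le hβ (by omega) (by omega) h2

/-! ### Space -/

theorem sum_words_le (S : Finset Interval) (Qs : List RestrictedRun)
    (h : ∀ Q ∈ Qs, Q.Invariant S) : (Qs.map RestrictedRun.words).sum ≤
      6 * Qs.length + 4 * ((Qs.map RestrictedRun.domain).map (optIn S)).sum := by
  induction Qs with
  | nil => simp
  | cons Q Qs ih =>
    have h1 := (h Q (by simp)).words_le
    have h2 := ih fun Q' hQ' => h Q' (by simp [hQ'])
    simp only [List.map_cons, List.sum_cons, List.length_cons]
    omega

theorem Run.Linked.words_le {β : ℝ} (hβ : 0 < β) {σ : ℕ → Interval} {t a : ℕ} {r : Run}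
    (h : r.Linked β σ t a) (hr : r.Valid σ t) :
    (r.words : ℝ) ≤ (42 + 12 * β) * ((opt (items σ (t - r.age) t)).card : ℝ) := by
  set M := (opt (items σ (t - r.age) t)).card with hM
  obtain ⟨-, u, h2, h3, P, Q, h4, h5, h6, h7, h8, h9, h10, h11⟩ := h
  have hsub : items σ u t ⊆ items σ (t - r.age) t := items_subset σ h2.le le_rfl
  have hle : ∀ R, optIn (items σ u t) R ≤ M := fun R =>
    (optIn_le _ R).trans (card_opt_mono hsub)
  have hlen : P.regions.length = P.size := by rw [h4.size_eq, CP.regions, List.length_map]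
  have h12 : r.cp.words ≤ 4 * M := by
    have := hr.2.2.size_le_opt_self
    rw [hr.2.2.size_eq] at this
    exact Nat.mul_le_mul_left 4 this
  have h13 : Q.size ≤ M :=
    h5.size_le_opt_self.trans (card_opt_mono (items_subset σ le_rfl h3))
  have h14 : r.snapshot.length ≤ M := by rw [h6]; exact h13
  have h15 := sum_words_le _ _ h9
  have h16 := sum_words_le _ _ h10
  rw [h7] at h15
  rw [h8] at h16
  have h17 := (h4.1.sum_optIn_le (items σ u t)).trans (hle _)
  have h18 : ((mergedPairs P.regions).map (optIn (items σ u t))).sum ≤ 2 * M := by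
    have hne := h4.regions_ne_nil
    have htil := h4.1
    revert hne htil
    cases P.regions with
    | nil => exact fun hne => absurd rfl hne
    | cons R Rs =>
      intro _ htil
      have h19 := htil.sum_optIn_mergedPairs_le (items σ u t)
      have h20 := hle ⟨.negInf, .posInf⟩
      have h21 := hle ⟨R.hi, .posInf⟩
      omega
  have h19 : r.singles.length = P.size := by
    rw [← hlen, ← h7, List.length_map]
  have h20 : r.pairs.length ≤ P.size := by
    rw [← hlen]
    refine le_trans (le_of_eq ?_) (length_mergedPairs_le P.regions)
    rw [← h8, List.length_map]
  have h21 : 1 ≤ M := hr.2.2.one_le_size.trans hr.2.2.size_le_opt_self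
  -- The age and the cells of `r` take at most 1 + 4M, the snapshot M, the single regions 6|P| + 4M
  -- and the pairs 6|P| + 8M words; the 1 is absorbed by M ≥ 1.
  have h22 : r.words ≤ 18 * M + 12 * P.size := by
    unfold Run.words
    omega
  -- The constant covers both alternatives of the link: 2 ≤ 2M and (1 + β)|Q| ≤ (1 + β)M. Then 18 +
  -- 12(2 + β) = 42 + 12β.
  have h23 : (P.size : ℝ) ≤ (2 + β) * M := by
    have h24 : (1 : ℝ) ≤ M := by exact_mod_cast h21
    rcases h11 with ⟨-, h11⟩ | h11
    · have : (P.size : ℝ) ≤ 2 := by exact_mod_cast h11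
      nlinarith
    · have : (Q.size : ℝ) ≤ M := by exact_mod_cast h13
      nlinarith
  have h24 : (r.words : ℝ) ≤ 18 * M + 12 * P.size := by exact_mod_cast h22
  linarith

theorem Run.IsOldest.words_le {β : ℝ} (hβ : 0 < β) {σ : ℕ → Interval} {L t : ℕ} {r : Run}
    (h : r.IsOldest β σ L t) (hr : r.Valid σ t) :
    (r.words : ℝ) ≤ (42 + 12 * β) * ((opt (items σ (t - r.age) t)).card : ℝ) := by
  rcases h with ⟨-, h1, h2, h3⟩ | ⟨a, -, h⟩
  · have h4 := hr.2.2.one_le_size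
    have h5 := hr.2.2.size_le_opt_self
    have h6 : r.words ≤ 42 * (opt (items σ (t - r.age) t)).card := by
      rw [hr.2.2.size_eq] at h4 h5
      simp only [Run.words, CP.words, h1, h2, h3, List.length_nil, List.map_nil, List.sum_nil]
      omega
    have h7 : (r.words : ℝ) ≤ 42 * ((opt (items σ (t - r.age) t)).card : ℝ) := by
      exact_mod_cast h6
    have : 0 ≤ 12 * β * ((opt (items σ (t - r.age) t)).card : ℝ) := by positivity
    linarith
  · exact h.words_le hβ hr

theorem Chained.forall_mem {β : ℝ} {σ : ℕ → Interval} {t : ℕ} {p : Run} {rs : List Run}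
    (h : Chained β σ t p rs) {r : Run} (hr : r ∈ rs) :
    r.Valid σ t ∧ t - p.age < t - r.age ∧ ∃ a, r.Linked β σ t a := by
  induction rs generalizing p with
  | nil => simp at hr
  | cons q rs ih =>
    rcases List.mem_cons.1 hr with rfl | hr
    · exact ⟨h.1, h.2.1.1, _, h.2.1⟩
    · obtain ⟨h1, h2, h3⟩ := ih h.2.2 hr
      exact ⟨h1, h.2.1.1.trans h2, h3⟩

/-- Only every second run is guaranteed a drop by the factor 1 + β, since an immediate successor may
have comparable size; hence the halved exponent. -/
theorem Sparse.pow_le_size {β : ℝ} (hβ : 0 < β) {p : Run} {rs : List Run}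
    (h : Sparse β (p :: rs)) (hpos : ∀ r ∈ p :: rs, 1 ≤ r.size) :
    (1 + β) ^ (rs.length / 2) ≤ (p.size : ℝ) := by
  induction hn : rs.length using Nat.strong_induction_on generalizing p rs with
  | _ n ih =>
  have hp : (1 : ℝ) ≤ p.size := by exact_mod_cast hpos p (by simp)
  match rs, hn with
  | [], hn => subst hn; simpa using hp
  | [q], hn => subst hn; simpa using hp
  | q :: r :: rs, hn =>
    have h1 := ih rs.length (by simp at hn; omega) h.2.2 (fun x hx => hpos x (by simp_all)) rfl
    have h2 := h.1 r (by simp)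
    have h3 : n / 2 = rs.length / 2 + 1 := by simp at hn; omega
    rw [h3, pow_succ]
    nlinarith

theorem usesSoftOSpaceOpt {β : ℝ} (hβ : 0 < β) :
    UsesSoftOSpaceOpt (fun L => slidingWindowAlgorithm β L) := by
  have hlog : 0 < Real.log (1 + β) := Real.log_pos (by linarith)
  -- The first factor, times 1 + log L, bounds the number of runs; the second, times |OPT|, bounds
  -- the words of one run.
  refine ⟨(2 + 2 / Real.log (1 + β)) * (42 + 12 * β), 1, fun L hL σ t => ?_⟩
  have hlogL : 0 ≤ Real.log L := Real.log_natCast_nonneg L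
  simp only [pow_one]
  cases t with
  | zero =>
    have : (slidingWindowAlgorithm β L).space ((slidingWindowAlgorithm β L).stateAt σ 0) = 0 := rfl
    rw [this, Nat.cast_zero]
    positivity
  | succ t =>
    obtain ⟨p, rs, h1, h2, h3, h4, h5, h6⟩ := stateInvariant β σ hL t
    rw [h1] at h6
    have h7 : (slidingWindowAlgorithm β L).space
        ((slidingWindowAlgorithm β L).stateAt σ (t + 1)) = ((p :: rs).map Run.words).sum := by
      rw [h1]
      rfl
    rw [h7, window_eq_items]
    set M := (opt (items σ (t + 1 - L) (t + 1))).card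
    have hmono : ∀ r : Run, t + 1 - p.age ≤ t + 1 - r.age →
        (42 + 12 * β) * ((opt (items σ (t + 1 - r.age) (t + 1))).card : ℝ) ≤
          (42 + 12 * β) * (M : ℝ) := by
      intro r hr
      have := card_opt_mono (items_subset σ (show t + 1 - L ≤ t + 1 - r.age by omega)
        (le_refl (t + 1)))
      exact mul_le_mul_of_nonneg_left (by exact_mod_cast this) (by positivity)
    have hall : ∀ r ∈ p :: rs, r.Valid σ (t + 1) ∧ (r.words : ℝ) ≤ (42 + 12 * β) * (M : ℝ) := by
      intro r hr
      rcases List.mem_cons.1 hr with rfl | hr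
      · exact ⟨h2, (h4.words_le hβ h2).trans (hmono r le_rfl)⟩
      · obtain ⟨h8, h9, a, h10⟩ := h5.forall_mem hr
        exact ⟨h8, (h10.words_le hβ h8).trans (hmono r h9.le)⟩
    have h8 : ((((p :: rs).map Run.words).sum : ℕ) : ℝ) ≤
        ((p :: rs).length : ℝ) * ((42 + 12 * β) * (M : ℝ)) := by
      rw [Nat.cast_list_sum, List.map_map]
      have := List.sum_le_card_nsmul ((p :: rs).map (Nat.cast ∘ Run.words))
        ((42 + 12 * β) * (M : ℝ)) (by
          intro x hx
          obtain ⟨r, hr, rfl⟩ := List.mem_map.1 hx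
          exact (hall r hr).2)
      simpa using this
    have h9 : (1 + β) ^ (rs.length / 2) ≤ (L : ℝ) :=
      (h6.pow_le_size hβ fun r hr => (hall r hr).1.2.2.one_le_size).trans
        (by exact_mod_cast h2.size_le_age.trans h3)
    have h10 : ((rs.length / 2 : ℕ) : ℝ) * Real.log (1 + β) ≤ Real.log L := by
      rw [← Real.log_pow]
      exact Real.log_le_log (by positivity) h9
    have h11 : ((rs.length / 2 : ℕ) : ℝ) ≤ Real.log L / Real.log (1 + β) :=
      (le_div_iff₀ hlog).2 h10
    have h12 : ((p :: rs).length : ℝ) ≤ 2 + 2 * ((rs.length / 2 : ℕ) : ℝ) := by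
      have : (p :: rs).length ≤ 2 + 2 * (rs.length / 2) := by
        rw [List.length_cons]
        omega
      exact_mod_cast this
    have h13 : ((p :: rs).length : ℝ) ≤ (2 + 2 / Real.log (1 + β)) * (1 + Real.log L) := by
      have h14 : (2 + 2 / Real.log (1 + β)) * (1 + Real.log L) =
          2 + 2 * (Real.log L / Real.log (1 + β)) + 2 * Real.log L + 2 / Real.log (1 + β) := by
        ring
      have h15 : 0 < 2 / Real.log (1 + β) := by positivity
      rw [h14]
      linarith
    calc ((((p :: rs).map Run.words).sum : ℕ) : ℝ)
        ≤ ((p :: rs).length : ℝ) * ((42 + 12 * β) * (M : ℝ)) := h8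
      _ ≤ (2 + 2 / Real.log (1 + β)) * (1 + Real.log L) * ((42 + 12 * β) * (M : ℝ)) :=
          mul_le_mul_of_nonneg_right h13 (by positivity)
      _ = _ := by ring

end IntervalSelection

theorem mainTheorem1 (δ : ℝ) (hδ : 0 < δ) :
    (∀ L : ℕ, 1 ≤ L →
      (IntervalSelection.slidingWindowAlgorithm (δ / 4) L).IsSlidingWindowApprox L (11 / 3 + δ)) ∧
    IntervalSelection.UsesSoftOSpaceOpt
      (fun L => IntervalSelection.slidingWindowAlgorithm (δ / 4) L) := by
  refine ⟨fun L hL => ?_, IntervalSelection.usesSoftOSpaceOpt (by positivity)⟩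
  have h := IntervalSelection.isSlidingWindowApprox (β := δ / 4) (by positivity) hL
  rwa [mul_div_cancel₀ δ (by norm_num : (4 : ℝ) ≠ 0)] at h
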